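/- **Setting.** Let $\mathcal C=\bigoplus_{(a,b)\in\mathbb Z^2}\mathcal C_{a,b}$ be a real $s$-multicomplex ($s<\infty$): linear maps $d_i$ of bidegree $(i,1-i)$, $i\ge 0$, with $d_i=0$ for $i>s$ and $\sum_{i+j=m}d_id_j=0$ for all $m\ge 0$; elements of $\mathcal C_{a,b}$ have weight $a$ and degree $a+b$. Suppose $\mathcal C$ carries a scalar product $\langle\cdot,\cdot\rangle$ for which different bidegrees are orthogonal (completeness is not required), and an associative, unital, graded-commutative product $\wedge$, additive on bidegrees, for which $d=d_0+\dots+d_s$ is a derivation ($d(\alpha\wedge\beta)=d\alpha\wedge\beta+(-1)^{\deg\alpha}\alpha\wedge d\beta$). Suppose also given a volume form $\mathrm{vol}\in\mathcal C_{Q,n-Q}$, a linear functional $\int$ on $\mathcal C_{Q,n-Q}$ satisfying Stokes' theorem ($\int d_i\omega=0$ for all $i$ and $\omega\in\mathcal C_{Q-i,n-Q-1+i}$), and a Hodge star, i.e. a linear operator $\star\colon\mathcal C_{p,k-p}\to\mathcal C_{Q-p,n-k-Q+p}$ with $\alpha\wedge\star\beta=(\alpha,\beta)\wedge\mathrm{vol}$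 for $\alpha,\beta\in\mathcal C_{p,k-p}$ and $\star\star=(-1)^{k(n-k)}$ in degree $k$; here $(\alpha,\beta)\in\mathcal C_{0,0}$ is bilinear and $\langle\alpha,\beta\rangle=\int(\alpha,\beta)\wedge\mathrm{vol}$. (For $(\alpha,\beta)=\langle\alpha,\beta\rangle 1$ and $\int\mathrm{vol}=1$ this is $\alpha\wedge\star\beta=\langle\alpha,\beta\rangle\,\mathrm{vol}$.) For $r\ge1$ let $Z_r^{p,q}$ be the set of $\alpha\in\mathcal C_{p,q}$ with $d_0\alpha=0$ for which there are $z_{p+j}\in\mathcal C_{p+j,q-j}$, $1\le j\le r-1$, with $d_m\alpha=\sum_{i=0}^{m-1}d_iz_{p+m-i}$ for $1\le m\le r-1$. Let $B_r^{p,q}$ be the set of $\sum_{k=0}^{r-1}d_kc_{p-k}$ with $c_{p-k}\in\mathcal C_{p-k,q-1+k}$ and $\sum_{k=l}^{r-1}d_{k-l}c_{p-k}=0$ for $1\le l\le r-1$. Assume that each $B_r^{p,q}$ is closed, in the sense that the orthogonal projection onto it exists: $\mathcal C_{p,q}=B_r^{p,q}\oplus\big((B_r^{p,q})^\perp\cap\mathcal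 C_{p,q}\big)$. When $\mathcal C_{p,q}$ is complete this means exactly that $B_r^{p,q}$ is topologically closed. Let $d_0^{-1}$ be the partial inverse of $d_0$ (project orthogonally to $\mathrm{Im}\,d_0$, then invert $d_0\colon(\ker d_0)^\perp\to\mathrm{Im}\,d_0$). For $r\ge1$ put $\partial_r=d_r-\sum_{j=1}^{r-1}d_{r-j}d_0^{-1}\partial_j$ and $d_c^r=\partial_r-d_0^{-1}d_0\partial_r-d_0d_0^{-1}\partial_r$. Let $E_0^{p,k}=\ker d_0\cap(\mathrm{Im}\,d_0)^\perp\cap\mathcal C_{p,k-p}$, let $I_{p,k}$ be the set of $j\ge1$ for which $d_c^j$ is non-zero on $E_0^{p,k}$, and let $E_{j,l}^{p,k-p}=Z_j^{p,k-p}\cap(B_l^{p,k-p})^\perp$. For $\alpha\in Z_j^{p,k-p}$ with elements $z_{p+i}$ as above, let $\Delta_j\alpha$ be the component of $d_j\alpha-\sum_{i=1}^{j-1}d_{j-i}z_{p+i}$ orthogonal to $B_j^{p+j,k+1-p-j}$. A *spectral complex* is a maximal string of maps $\Delta_{j_k}\colon E_{j_k,j_{k-1}}^{p_k,k-p_k}\to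 E_{j_{k+1},j_k}^{p_{k+1},k+1-p_{k+1}}$, with $k$ running over a non-empty interval of degrees, $p_{k+1}=p_k+j_k$, $j_k\in I_{p_k,k}$ and $E_0^{p_k,k}\ne0$. Maximal means that the string ends on the right at a $k$ only if $I_{p_k,k}=\emptyset$, and starts at a $k$ only if no $l$ lies in $I_{p_k-l,k-1}$; the index not determined by a map at an end is an arbitrary positive integer. **Proposition (closure under the Hodge star).** 1. For all $r_1,r_2\ge1$ and all $p,k\in\mathbb Z$, $$\star\Big[Z_{r_1}^{p,k-p}\cap\big(B_{r_2}^{p,k-p}\big)^\perp\Big]=Z_{r_2}^{Q-p,n-k-Q+p}\cap\big(B_{r_1}^{Q-p,n-k-Q+p}\big)^\perp .$$ 2. The collection of spectral complexes is closed under Hodge duality: for every spectral complex with data $(p_k,j_k)$, the weights $p'_k=Q-p_{n-k}$ and indices $j'_k=j_{n-k-1}$, on the reflected interval of degrees, define a spectral complex; $\star$ maps the space of the first in degree $k$ onto the space of the second in degree $n-k$; and for $\alpha$, $\beta$ in the spaces of the first in consecutive degrees $k$, $k+1$, $$\langle\Delta_{j_k}\alpha,\beta\rangle=(-1)^{nk+1}\langle\alpha,\star\Delta_{j_k}\star\beta\rangle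 .$$ 3. An individual spectral complex need not be closed under $\star$: there are a structure as above and a spectral complex, with at least two degrees and with interval of degrees symmetric under $k\mapsto n-k$, for which $\star$ does not map its space in degree $k$ onto its own space in degree $n-k$ for every $k$. -/

import Mathlib

universe u

/-- A truncated multicomplex with a scalar product. The bigraded real vector space is the
internal direct sum `T = ⨁ C a b` (`a` is the weight, `a + b` the degree), pieces of different
bidegree are orthogonal, and `d i` are the structure maps, of bidegree `(i, 1 - i)`.
No completeness of `T` and no continuity of the structure maps is required. -/
structure Multicomplex (T : Type u) [NormedAddCommGroup T] [InnerProductSpace ℝ T] where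
  C : ℤ → ℤ → Submodule ℝ T
  isInternal : DirectSum.IsInternal (fun ab : ℤ × ℤ => C ab.1 ab.2)
  orthogonal : ∀ a b a' b' : ℤ, (a, b) ≠ (a', b') → (C a b).IsOrtho (C a' b')
  s : ℕ
  d : ℕ → T →ₗ[ℝ] T
  d_mem : ∀ (i : ℕ) (a b : ℤ) (x : T), x ∈ C a b → d i x ∈ C (a + i) (b + 1 - i)
  d_eq_zero : ∀ i : ℕ, s < i → d i = 0
  d_comp : ∀ m : ℕ, ∑ i ∈ Finset.range (m + 1), (d i) ∘ₗ (d (m - i)) = 0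

namespace Multicomplex

variable {T : Type u} [NormedAddCommGroup T] [InnerProductSpace ℝ T] (M : Multicomplex T)

/-- `z 1, …, z (r - 1)` are witnesses for `α ∈ Z_r^{a,b}`: `d_0 α = 0`, and
`d_m α = ∑_{i < m} d_i z_{m - i}` for `1 ≤ m ≤ r - 1`, where `z j` has bidegree
`(a + j, b - j)`. -/
def IsZWitness (r : ℕ) (a b : ℤ) (α : T) (z : ℕ → T) : Prop :=
  α ∈ M.C a b ∧ (∀ j : ℕ, z j ∈ M.C (a + j) (b - j)) ∧ M.d 0 α = 0 ∧
    ∀ m : ℕ, 1 ≤ m → m < r → M.d m α = ∑ i ∈ Finset.range m, M.d i (z (m - i))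

/-- The graded submodule `Z_r^{a,b}` of `C a b`. -/
def Z (r : ℕ) (a b : ℤ) : Submodule ℝ T where
  carrier := {α | ∃ z : ℕ → T, M.IsZWitness r a b α z}
  zero_mem' := ⟨fun _ => 0, by
    refine ⟨Submodule.zero_mem _, fun _ => Submodule.zero_mem _, by simp, ?_⟩
    intro m _ _
    simp⟩
  add_mem' := by
    rintro x y ⟨z, hx, hz, h0, h⟩ ⟨w, hy, hw, g0, g⟩
    refine ⟨fun j => z j + w j, Submodule.add_mem _ hx hy,
      fun j => Submodule.add_mem _ (hz j) (hw j), by simp [h0, g0], ?_⟩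
    intro m h1 h2
    simp [h m h1 h2, g m h1 h2, Finset.sum_add_distrib]
  smul_mem' := by
    rintro c x ⟨z, hx, hz, h0, h⟩
    refine ⟨fun j => c • z j, Submodule.smul_mem _ _ hx,
      fun j => Submodule.smul_mem _ _ (hz j), by simp [h0], ?_⟩
    intro m h1 h2
    simp [h m h1 h2, Finset.smul_sum]

/-- The graded submodule `B_r^{a,b}` of `C a b`: all `∑_{k < r} d_k c_k` with `c k` of
bidegree `(a - k, b - 1 + k)` and `∑_{l ≤ k < r} d_{k - l} c_k = 0` for `1 ≤ l ≤ r - 1`. -/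
def B (r : ℕ) (a b : ℤ) : Submodule ℝ T where
  carrier := {α | ∃ c : ℕ → T, (∀ k : ℕ, c k ∈ M.C (a - k) (b - 1 + k)) ∧
    α = ∑ k ∈ Finset.range r, M.d k (c k) ∧
    ∀ l : ℕ, 1 ≤ l → l < r → ∑ k ∈ Finset.Ico l r, M.d (k - l) (c k) = 0}
  zero_mem' := ⟨fun _ => 0, fun _ => Submodule.zero_mem _, by simp, by simp⟩
  add_mem' := by
    rintro x y ⟨z, hz, h0, h⟩ ⟨w, hw, g0, g⟩
    refine ⟨fun j => z j + w j, fun j => Submodule.add_mem _ (hz j) (hw j),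
      by simp [h0, g0, Finset.sum_add_distrib], ?_⟩
    intro m h1 h2
    simp [Finset.sum_add_distrib, h m h1 h2, g m h1 h2]
  smul_mem' := by
    rintro c x ⟨z, hz, h0, h⟩
    refine ⟨fun j => c • z j, fun j => Submodule.smul_mem _ _ (hz j),
      by simp [h0, Finset.smul_sum], ?_⟩
    intro m h1 h2
    simp [← Finset.smul_sum, h m h1 h2]

/-- Every `B_r^{a,b}`, `r ≥ 1`, is closed, in the sense of scalar product spaces that need not be
complete: the orthogonal projection onto it exists. If `C a b` is complete this is
topological closedness, see `hasOrthogonalProjection_B_iff_isClosed`. -/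
def BClosed : Prop :=
  ∀ (r : ℕ) (a b : ℤ), 1 ≤ r → (M.B r a b).HasOrthogonalProjection

theorem B_le (r : ℕ) (a b : ℤ) : M.B r a b ≤ M.C a b := by
  rintro x ⟨c, hc, rfl, -⟩
  refine Submodule.sum_mem _ fun k _ => ?_
  have h := M.d_mem k _ _ _ (hc k)
  have e1 : a - (k : ℤ) + k = a := by ring
  have e2 : b - 1 + (k : ℤ) + 1 - k = b := by ring
  rwa [e1, e2] at h

theorem hasOrthogonalProjection_B_iff_isClosed (r : ℕ) (a b : ℤ) [CompleteSpace (M.C a b)] :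
    (M.B r a b).HasOrthogonalProjection ↔ IsClosed (M.B r a b : Set T) := by
  constructor
  · intro h
    have h2 : (M.B r a b)ᗮᗮ = M.B r a b := Submodule.orthogonal_orthogonal _
    rw [← h2]
    exact Submodule.isClosed_orthogonal _
  · intro h
    have hC : IsComplete (M.C a b : Set T) := completeSpace_coe_iff_isComplete.mp inferInstance
    have hB : IsComplete (M.B r a b : Set T) := by
      intro f hf hle
      obtain ⟨x, -, hx⟩ := hC f hf
        (hle.trans (Filter.principal_mono.mpr fun y hy => M.B_le r a b hy))
      have : f.NeBot := hf.1
      exact ⟨x, h.mem_of_tendsto hx (Filter.le_principal_iff.mp hle), hx⟩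
    have : CompleteSpace (M.B r a b) := completeSpace_coe_iff_isComplete.mpr hB
    infer_instance

/-- `G` is the partial inverse `d_0⁻¹ ∘ pr_{Im d_0}`: `G y` is the element of `(ker d_0)ᗮ` that
`d_0` maps to the orthogonal projection of `y` to `Im d_0`. There is at most one such `G`. -/
def IsPartialInverse (G : T →ₗ[ℝ] T) : Prop :=
  ∀ y : T, G y ∈ (LinearMap.ker (M.d 0))ᗮ ∧ y - M.d 0 (G y) ∈ (LinearMap.range (M.d 0))ᗮ

open Classical in
/-- The partial inverse `d_0⁻¹` (zero if it does not exist). -/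
noncomputable def d0inv : T →ₗ[ℝ] T :=
  if h : ∃ G, M.IsPartialInverse G then h.choose else 0

/-- `∂_r = d_r - ∑_{1 ≤ j < r} d_{r - j} d_0⁻¹ ∂_j` (used for `r ≥ 1`). -/
noncomputable def del (r : ℕ) : T →ₗ[ℝ] T :=
  M.d r - ∑ j ∈ (Finset.Ico 1 r).attach, (M.d (r - j.1)) ∘ₗ M.d0inv ∘ₗ (del j.1)
termination_by r
decreasing_by exact (Finset.mem_Ico.mp j.2).2

/-- The component `d_c^r = ∂_r - d_0⁻¹ d_0 ∂_r - d_0 d_0⁻¹ ∂_r` of the Rumin differential. -/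
noncomputable def dc (r : ℕ) : T →ₗ[ℝ] T :=
  M.del r - M.d0inv ∘ₗ M.d 0 ∘ₗ M.del r - M.d 0 ∘ₗ M.d0inv ∘ₗ M.del r

/-- The Rumin forms of weight `p` and degree `k`. -/
noncomputable def rumin (p k : ℤ) : Submodule ℝ T :=
  LinearMap.ker (M.d 0) ⊓ (LinearMap.range (M.d 0))ᗮ ⊓ M.C p (k - p)

/-- The index set `I_{p,k}`: the `j ≥ 1` for which `d_c^j` is non-trivial on the Rumin forms of
weight `p` and degree `k`. -/
noncomputable def I (p k : ℤ) : Set ℕ :=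
  {j | 1 ≤ j ∧ ∃ x ∈ M.rumin p k, M.dc j x ≠ 0}

/-- `E_{j,l}^{p,k-p} = Z_j^{p,k-p} ∩ (B_l^{p,k-p})ᗮ`. -/
noncomputable def E (j l : ℕ) (p k : ℤ) : Submodule ℝ T :=
  M.Z j p (k - p) ⊓ (M.B l p (k - p))ᗮ

/-- `β` is the value `Δ_j α` for `α ∈ Z_j^{p,k-p}`: the component of
`d_j α - ∑_{1 ≤ i < j} d_{j - i} z_i` orthogonal to `B_j^{p+j,k+1-p-j}`. -/
def IsDelta (j : ℕ) (p k : ℤ) (α β : T) : Prop :=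
  ∃ z : ℕ → T, M.IsZWitness j p (k - p) α z ∧
    β ∈ (M.B j (p + j) (k + 1 - p - j))ᗮ ∧
    (M.d j α - ∑ i ∈ Finset.Ico 1 j, M.d (j - i) (z i)) - β ∈ M.B j (p + j) (k + 1 - p - j)

open Classical in
/-- The differential `Δ_j` on `Z_j^{p,k-p}`, with values orthogonal to `B_j^{p+j,k+1-p-j}`
(zero where `IsDelta` has no solution; the solution is unique). -/
noncomputable def Delta (j : ℕ) (p k : ℤ) (α : T) : T :=
  if h : ∃ β, M.IsDelta j p k α β then h.choose else 0

/-- A member of the collection of spectral complexes: a maximal string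
`⋯ → E_{j_k, j_{k-1}}^{p_k, k - p_k} --Δ_{j_k}--> E_{j_{k+1}, j_k}^{p_{k+1}, k+1-p_{k+1}} → ⋯`
with `p_{k+1} = p_k + j_k` and `j_k ∈ I_{p_k,k}`, passing through non-zero spaces of Rumin forms.
Here `k` runs over an interval `supp` of degrees, `p_k = wt k` and `j_k = jump k`. The
string stops on the right (left) only where no `d_c^j` leaves (enters) non-trivially; the one
index that is not determined by a map there is an arbitrary positive integer. -/
structure SpectralComplex where
  supp : Set ℤ
  wt : ℤ → ℤ
  jump : ℤ → ℕ
  supp_nonempty : supp.Nonempty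
  supp_ordConnected : supp.OrdConnected
  jump_pos : ∀ k, 1 ≤ jump k
  rumin_ne_bot : ∀ k ∈ supp, M.rumin (wt k) k ≠ ⊥
  wt_succ : ∀ k ∈ supp, k + 1 ∈ supp → wt (k + 1) = wt k + jump k
  jump_mem : ∀ k ∈ supp, k + 1 ∈ supp → jump k ∈ M.I (wt k) k
  right_end : ∀ k ∈ supp, k + 1 ∉ supp → M.I (wt k) k = ∅
  left_end : ∀ k ∈ supp, k - 1 ∉ supp → ∀ l : ℕ, l ∉ M.I (wt k - l) (k - 1)

namespace SpectralComplex

variable {M} (X : M.SpectralComplex)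

open Classical in
/-- The space of the complex in degree `k`. -/
noncomputable def space (k : ℤ) : Submodule ℝ T :=
  if k ∈ X.supp then M.E (X.jump k) (X.jump (k - 1)) (X.wt k) k else ⊥

/-- The differential of the complex from degree `k` to degree `k + 1`. -/
noncomputable def diff (k : ℤ) : T → T :=
  M.Delta (X.jump k) (X.wt k) k

end SpectralComplex

end Multicomplex

/-- A commutative differential graded algebra whose underlying complex is a multicomplex with
scalar product, with a volume form `vol` of weight `Q` and degree `n` and its Hodge star.
The product is additive on weights, so the Leibniz rule and Stokes' theorem for
`d = d_0 + ⋯ + d_s` are those for the components `d_i`.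

The defining relation `α ∧ ⋆β = ⟨α, β⟩ vol` is `wedge_star`, where the density `dens α β` has
values in the weight `0`, degree `0` elements (functions), and the scalar product is its
integral. A scalar product with `α ∧ ⋆β = ⟨α, β⟩ vol` literally is the case
`dens α β = ⟨α, β⟩ • 1`, `∫ vol = 1`; smooth forms on a closed manifold with the `L²` scalar
product are the case in which `dens` is the pointwise scalar product. -/
structure HodgeMulticomplex (T : Type u) [NormedAddCommGroup T] [InnerProductSpace ℝ T]
    extends Multicomplex T where
  wedge : T →ₗ[ℝ] T →ₗ[ℝ] T
  one : T
  one_mem : one ∈ C 0 0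
  one_wedge : ∀ x, wedge one x = x
  wedge_assoc : ∀ x y z, wedge (wedge x y) z = wedge x (wedge y z)
  wedge_mem : ∀ (a b a' b' : ℤ) (x y : T), x ∈ C a b → y ∈ C a' b' →
    wedge x y ∈ C (a + a') (b + b')
  wedge_comm : ∀ (a b a' b' : ℤ) (x y : T), x ∈ C a b → y ∈ C a' b' →
    wedge x y = (-1 : ℝ) ^ ((a + b) * (a' + b')) • wedge y x
  leibniz : ∀ (i : ℕ) (a b : ℤ) (x y : T), x ∈ C a b →
    d i (wedge x y) = wedge (d i x) y + (-1 : ℝ) ^ (a + b) • wedge x (d i y)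
  n : ℤ
  Q : ℤ
  vol : T
  vol_mem : vol ∈ C Q (n - Q)
  integral : T →ₗ[ℝ] ℝ
  stokes : ∀ (i : ℕ) (ω : T), ω ∈ C (Q - i) (n - Q - 1 + i) → integral (d i ω) = 0
  dens : T →ₗ[ℝ] T →ₗ[ℝ] T
  dens_mem : ∀ (a b : ℤ) (x y : T), x ∈ C a b → y ∈ C a b → dens x y ∈ C 0 0
  inner_eq : ∀ (a b : ℤ) (x y : T), x ∈ C a b → y ∈ C a b →
    inner ℝ x y = integral (wedge (dens x y) vol)
  hodge : T →ₗ[ℝ] T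
  hodge_mem : ∀ (a b : ℤ) (x : T), x ∈ C a b → hodge x ∈ C (Q - a) (n - Q - b)
  wedge_star : ∀ (a b : ℤ) (x y : T), x ∈ C a b → y ∈ C a b →
    wedge x (hodge y) = wedge (dens x y) vol
  hodge_hodge : ∀ (a b : ℤ) (x : T), x ∈ C a b →
    hodge (hodge x) = (-1 : ℝ) ^ ((a + b) * (n - (a + b))) • x

/-!
The Hodge star turns the scalar product into the Poincaré pairing `∫ x ∧ y`, since
`∫ x ∧ ⋆y = ⟨x, y⟩`. By Stokes' theorem and the Leibniz rule, every `d_i` is skew for this pairing,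
up to a sign that depends only on the degree (`pairing_d`). So no adjoints of the `d_i` are needed, and
the bookkeeping of signs is reduced to one factor.

The first claim says that, under the pairing, the annihilator of `B_r` is `Z_r` in the
complementary bidegree. That `B_r` and `Z_r` annihilate each other is an exchange of sums
(`pairing_eq_zero_of_mem_B_of_mem_Z`). Conversely, let `y` annihilate `B_{r+1}`
(`mem_Z_of_forall_pairing_B`). By induction on `r`, `y` has a witness of order `r`, and the
obstruction to extending it is `d_r y - ∑ d_{r-i} z_i`. Changing the
witness changes this obstruction by elements of `B_r` (`mem_Z_succ_of_leading_mem_B`). Pairing it with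
`ζ ∈ Z_r` gives, up to sign, the pairing of `y` with `d_r ζ - ∑ d_{r-i} w_i`
(`pairing_leading`), which lies in `B_{r+1}` (`leading_mem_B`), hence zero. So the obstruction
annihilates `Z_r`, and as `B_r` is closed it lies in `B_r`.

For the second claim, `pairing_leading` also gives the adjointness of `Δ_j` and `⋆ Δ_j ⋆`. The
combinatorial part is that `I_{p,k}` is compatible with duality. Closedness of the image of `d_0`,
together with duality, yields the partial inverse `d_0⁻¹`; it is graded symmetric for the pairing
(`pairing_d0inv`). Then `∂_r` is skew, because its recursion has a mirror image
(`del_apply_right`, `pairing_del`), and `d_c^r` is `∂_r` followed by the projection to the Rumin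
forms, so it is non-zero exactly when its dual is (`mem_I_dual`).

The counterexample is a six-dimensional Poincaré duality algebra `1, x₁, x₂, y₂, y₁, vol` with
`d x₁ = y₂` and `d x₂ = y₁`, where `x₁` and `x₂` have different weights: the spectral complexes
`x₁ → y₂` and `x₂ → y₁` are exchanged by the Hodge star.
-/

/-! ### Cycles and boundaries of a multicomplex -/

namespace Multicomplex

variable {T : Type u} [NormedAddCommGroup T] [InnerProductSpace ℝ T] (M : Multicomplex T)

theorem mem_C_of_eq {x : T} {a b a' b' : ℤ} (hx : x ∈ M.C a b) (ha : a = a') (hb : b = b') :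
    x ∈ M.C a' b' := by
  subst ha hb
  exact hx

theorem d_mem_of_eq {x : T} {a b a' b' : ℤ} {i : ℕ} (hx : x ∈ M.C a b) (ha : a' = a + i)
    (hb : b' = b + 1 - i) : M.d i x ∈ M.C a' b' := by
  subst ha hb
  exact M.d_mem i a b x hx

/-- A property that is stable under addition holds everywhere if it holds on the homogeneous
elements. -/
theorem homogeneous_induction {P : T → Prop} (hom : ∀ a b x, x ∈ M.C a b → P x)
    (add : ∀ x y, P x → P y → P (x + y)) (t : T) : P t := by
  have ht : t ∈ ⨆ ab : ℤ × ℤ, M.C ab.1 ab.2 := by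
    rw [M.isInternal.submodule_iSup_eq_top]
    trivial
  exact Submodule.iSup_induction (fun ab : ℤ × ℤ => M.C ab.1 ab.2) (motive := P) ht
    (fun ab x hx => hom ab.1 ab.2 x hx) (hom 0 0 0 (Submodule.zero_mem _)) add

theorem inner_eq_zero_of_ne {a b a' b' : ℤ} (h : (a, b) ≠ (a', b')) {x y : T}
    (hx : x ∈ M.C a b) (hy : y ∈ M.C a' b') : inner ℝ x y = 0 :=
  (Submodule.isOrtho_iff_inner_eq.mp (M.orthogonal a b a' b' h)) x hx y hy

variable {M}

/-- The defining equations of a witness, indexed by the position of the witness elements. -/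
theorem IsZWitness.d_eq {r : ℕ} {a b : ℤ} {α : T} {z : ℕ → T} (h : M.IsZWitness r a b α z)
    {m : ℕ} (hm : m < r) : M.d m α = ∑ l ∈ Finset.Ico 1 (m + 1), M.d (m - l) (z l) := by
  rcases Nat.eq_zero_or_pos m with rfl | hm0
  · simpa using h.2.2.1
  rw [h.2.2.2 m hm0 hm]
  refine Finset.sum_nbij' (fun i => m - i) (fun l => m - l) ?_ ?_ ?_ ?_ ?_
  · intro i hi
    simp only [Finset.mem_range, Finset.mem_Ico] at hi ⊢
    omega
  · intro i hi
    simp only [Finset.mem_range, Finset.mem_Ico] at hi ⊢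
    omega
  · intro i hi
    simp only [Finset.mem_range] at hi
    omega
  · intro i hi
    simp only [Finset.mem_Ico] at hi
    omega
  · intro i hi
    simp only [Finset.mem_range] at hi
    congr 2
    omega

theorem isZWitness_of_d_eq {r : ℕ} {a b : ℤ} {α : T} {z : ℕ → T} (hα : α ∈ M.C a b)
    (hz : ∀ j : ℕ, z j ∈ M.C (a + j) (b - j)) (h0 : M.d 0 α = 0)
    (h : ∀ m, 1 ≤ m → m < r → M.d m α = ∑ l ∈ Finset.Ico 1 (m + 1), M.d (m - l) (z l)) :
    M.IsZWitness r a b α z := by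
  refine ⟨hα, hz, h0, fun m hm0 hm => ?_⟩
  rw [h m hm0 hm]
  refine Finset.sum_nbij' (fun l => m - l) (fun i => m - i) ?_ ?_ ?_ ?_ ?_
  · intro i hi
    simp only [Finset.mem_range, Finset.mem_Ico] at hi ⊢
    omega
  · intro i hi
    simp only [Finset.mem_range, Finset.mem_Ico] at hi ⊢
    omega
  · intro i hi
    simp only [Finset.mem_Ico] at hi
    omega
  · intro i hi
    simp only [Finset.mem_range] at hi
    omega
  · intro i hi
    simp only [Finset.mem_Ico] at hi
    congr 2
    omega

variable (M)

theorem Z_le (r : ℕ) (a b : ℤ) : M.Z r a b ≤ M.C a b := fun _ ⟨_, hz⟩ => hz.1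

/-- The element `d_r α - ∑_{1 ≤ i < r} d_{r - i} z_i` whose component orthogonal to `B_r` is
`Δ_r α`. -/
def leading (r : ℕ) (α : T) (z : ℕ → T) : T :=
  M.d r α - ∑ i ∈ Finset.Ico 1 r, M.d (r - i) (z i)

variable {M}

theorem IsZWitness.leading_mem_C {r : ℕ} {a b : ℤ} {α : T} {z : ℕ → T}
    (h : M.IsZWitness r a b α z) : M.leading r α z ∈ M.C (a + r) (b + 1 - r) := by
  refine Submodule.sub_mem _ (M.d_mem r a b α h.1) (Submodule.sum_mem _ fun i hi => ?_)
  simp only [Finset.mem_Ico] at hi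
  have : ((r - i : ℕ) : ℤ) = r - i := by omega
  refine M.d_mem_of_eq (h.2.1 i) ?_ ?_ <;> rw [this] <;> ring

/-- The representatives of `Δ_r α` are boundaries of the next order: the coefficients are `α`
and the negatives of the elements of the witness. -/
theorem IsZWitness.leading_mem_B {r : ℕ} {a b : ℤ} {α : T} {z : ℕ → T}
    (h : M.IsZWitness r a b α z) : M.leading r α z ∈ M.B (r + 1) (a + r) (b + 1 - r) := by
  -- `c r = α` and `c (r - i) = - z i` for `1 ≤ i < r`; `c 0 = 0`, as `z r` does not occur
  let c : ℕ → T := fun k => if k = r then α else if 1 ≤ k ∧ k < r then - z (r - k) else 0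
  have hcr : c r = α := by simp [c]
  have hc : ∀ k, 1 ≤ k → k < r → c k = - z (r - k) := fun k h1 h2 => by
    simp [c, h1, h2, h2.ne]
  refine ⟨c, fun k => ?_, ?_, fun l hl1 hl2 => ?_⟩
  · by_cases hk : k = r
    · subst hk
      rw [hcr]
      exact M.mem_C_of_eq h.1 (by ring) (by ring)
    · by_cases hk2 : 1 ≤ k ∧ k < r
      · rw [hc k hk2.1 hk2.2]
        have : ((r - k : ℕ) : ℤ) = r - k := by omega
        refine Submodule.neg_mem _ (M.mem_C_of_eq (h.2.1 (r - k)) ?_ ?_) <;> rw [this] <;> ring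
      · simp [c, hk, hk2]
  · rw [Finset.sum_range_succ, hcr, leading, sub_eq_neg_add, ← Finset.sum_neg_distrib]
    congr 1
    rcases Nat.eq_zero_or_pos r with rfl | hr
    · simp
    rw [Finset.range_eq_Ico, Finset.sum_eq_sum_Ico_succ_bot hr]
    have h0 : M.d 0 (c 0) = 0 := by
      have : (0 : ℕ) ≠ r := by omega
      simp [c, this]
    rw [h0, zero_add]
    refine Finset.sum_nbij' (fun i => r - i) (fun i => r - i) ?_ ?_ ?_ ?_ ?_
    iterate 4
      intro i hi
      simp only [Finset.mem_Ico] at hi ⊢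
      omega
    intro i hi
    simp only [Finset.mem_Ico] at hi
    rw [hc (r - i) (by omega) (by omega), map_neg]
    congr 3
    omega
  · rw [Finset.sum_Ico_succ_top (by omega), hcr, h.d_eq (m := r - l) (by omega)]
    rw [← sub_neg_eq_add, sub_eq_zero, ← Finset.sum_neg_distrib]
    refine Finset.sum_nbij' (fun i => r - i) (fun i => r - i) ?_ ?_ ?_ ?_ ?_
    iterate 4
      intro i hi
      simp only [Finset.mem_Ico] at hi ⊢
      omega
    intro i hi
    simp only [Finset.mem_Ico] at hi
    rw [hc i (by omega) (by omega), map_neg]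
    congr 3
    omega

variable (M)

theorem B_le_succ (r : ℕ) (a b : ℤ) : M.B r a b ≤ M.B (r + 1) a b := by
  rintro x ⟨c, hc, rfl, h⟩
  refine ⟨fun k => if k < r then c k else 0, fun k => ?_, ?_, fun l hl1 hl2 => ?_⟩
  · dsimp only
    split_ifs
    · exact hc k
    · exact Submodule.zero_mem _
  · rw [Finset.sum_range_succ]
    simp only [lt_irrefl, if_false, map_zero, add_zero]
    refine Finset.sum_congr rfl fun k hk => ?_
    rw [if_pos (Finset.mem_range.mp hk)]
  · rw [Finset.sum_Ico_succ_top (by omega)]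
    simp only [lt_irrefl, if_false, map_zero, add_zero]
    rcases Nat.lt_or_ge l r with hl | hl
    · rw [← h l hl1 hl]
      refine Finset.sum_congr rfl fun k hk => ?_
      rw [if_pos (Finset.mem_Ico.mp hk).2]
    · rw [Finset.Ico_eq_empty (by omega), Finset.sum_empty]

/-- If a representative of `Δ_r α` lies in `B_r`, the witness can be corrected by the
coefficients of this boundary to one of the next order. -/
theorem mem_Z_succ_of_leading_mem_B {r : ℕ} (hr : 1 ≤ r) {a b : ℤ} {α : T} {z : ℕ → T}
    (h : M.IsZWitness r a b α z) (hB : M.leading r α z ∈ M.B r (a + r) (b + 1 - r)) :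
    α ∈ M.Z (r + 1) a b := by
  obtain ⟨c, hc, hsum, hrel⟩ := hB
  refine ⟨fun j => (if j < r then z j else 0) + (if j ≤ r then c (r - j) else 0),
    isZWitness_of_d_eq h.1 (fun j => ?_) h.2.2.1 fun m hm1 hm2 => ?_⟩
  · refine Submodule.add_mem _ ?_ ?_
    · split_ifs
      · exact h.2.1 j
      · exact Submodule.zero_mem _
    · split_ifs with hj
      · have : ((r - j : ℕ) : ℤ) = r - j := by omega
        refine M.mem_C_of_eq (hc (r - j)) ?_ ?_ <;> rw [this] <;> ring
      · exact Submodule.zero_mem _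
  simp only [map_add, Finset.sum_add_distrib]
  have e : ∑ l ∈ Finset.Ico 1 (m + 1), M.d (m - l) (if l ≤ r then c (r - l) else 0) =
      ∑ k ∈ Finset.Ico (r - m) r, M.d (k - (r - m)) (c k) := by
    refine Finset.sum_nbij' (fun i => r - i) (fun i => r - i) ?_ ?_ ?_ ?_ ?_
    iterate 4
      intro i hi
      simp only [Finset.mem_Ico] at hi ⊢
      omega
    intro i hi
    simp only [Finset.mem_Ico] at hi
    rw [if_pos (by omega)]
    congr 2
    omega
  rw [e]
  rcases Nat.lt_or_ge m r with hm | hm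
  · rw [hrel (r - m) (by omega) (by omega), add_zero, h.d_eq hm]
    refine Finset.sum_congr rfl fun l hl => ?_
    rw [if_pos (by simp only [Finset.mem_Ico] at hl; omega)]
  · obtain rfl : m = r := by omega
    rw [Finset.sum_Ico_succ_top hm1, if_neg (lt_irrefl _), map_zero, add_zero]
    simp only [Nat.sub_self, Nat.sub_zero]
    rw [← Finset.range_eq_Ico, ← hsum, leading, ← sub_eq_iff_eq_add']
    congr 1
    refine Finset.sum_congr rfl fun l hl => ?_
    rw [if_pos (Finset.mem_Ico.mp hl).2]

theorem mem_Z_one_iff {a b : ℤ} {x : T} : x ∈ M.Z 1 a b ↔ x ∈ M.C a b ∧ M.d 0 x = 0 := by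
  refine ⟨fun ⟨z, hz⟩ => ⟨hz.1, hz.2.2.1⟩, fun h => ⟨fun _ => 0, h.1, fun _ =>
    Submodule.zero_mem _, h.2, fun m h1 h2 => by omega⟩⟩

theorem mem_B_one_iff {a b : ℤ} {x : T} :
    x ∈ M.B 1 a b ↔ ∃ c ∈ M.C a (b - 1), x = M.d 0 c := by
  constructor
  · rintro ⟨c, hc, rfl, -⟩
    exact ⟨c 0, M.mem_C_of_eq (hc 0) (by simp) (by simp), by simp⟩
  · rintro ⟨c, hc, rfl⟩
    refine ⟨fun k => if k = 0 then c else 0, fun k => ?_, by simp, fun l h1 h2 => by omega⟩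
    dsimp only
    split_ifs with hk
    · subst hk
      exact M.mem_C_of_eq hc (by simp) (by simp)
    · exact Submodule.zero_mem _

end Multicomplex

/-! ### The Poincaré pairing and the duality of cycles and boundaries -/

namespace HodgeMulticomplex

variable {T : Type u} [NormedAddCommGroup T] [InnerProductSpace ℝ T] (M : HodgeMulticomplex T)

/-- The Poincaré pairing `∫ x ∧ y`. -/
def pairing : T →ₗ[ℝ] T →ₗ[ℝ] ℝ := M.wedge.compr₂ M.integral

theorem pairing_apply (x y : T) : M.pairing x y = M.integral (M.wedge x y) := rfl

theorem pairing_hodge {a b : ℤ} {x y : T} (hx : x ∈ M.C a b) (hy : y ∈ M.C a b) :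
    M.pairing x (M.hodge y) = inner ℝ x y := by
  rw [pairing_apply, M.wedge_star a b x y hx hy, M.inner_eq a b x y hx hy]

theorem pairing_comm {a b a' b' : ℤ} {x y : T} (hx : x ∈ M.C a b) (hy : y ∈ M.C a' b') :
    M.pairing x y = (-1 : ℝ) ^ ((a + b) * (a' + b')) * M.pairing y x := by
  rw [pairing_apply, M.wedge_comm a b a' b' x y hx hy, map_smul, smul_eq_mul, pairing_apply]

theorem neg_one_zpow_mul_self (k : ℤ) : (-1 : ℝ) ^ k * (-1 : ℝ) ^ k = 1 := by
  rw [← mul_zpow]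
  simp

/-- Stokes' theorem and the Leibniz rule: the structure maps are skew for the Poincaré pairing. -/
theorem pairing_d {i : ℕ} {a b a' b' k : ℤ} {x y : T} (hx : x ∈ M.C a b) (hy : y ∈ M.C a' b')
    (hk : a + b = k) (hQ : a + a' + i = M.Q) (hn : a + b + a' + b' + 1 = M.n) :
    M.pairing (M.d i x) y = -(-1 : ℝ) ^ k * M.pairing x (M.d i y) := by
  have h := M.stokes i (M.wedge x y)
    (M.mem_C_of_eq (M.wedge_mem a b a' b' x y hx hy) (by linarith) (by linarith))
  rw [M.leibniz i a b x y hx, map_add, map_smul, smul_eq_mul, hk] at h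
  rw [pairing_apply, pairing_apply]
  linarith

theorem hodge_mem_of_eq {x : T} {a b a' b' : ℤ} (hx : x ∈ M.C a b) (ha : a + a' = M.Q)
    (hn : a + b + a' + b' = M.n) : M.hodge x ∈ M.C a' b' :=
  M.mem_C_of_eq (M.hodge_mem a b x hx) (by linarith) (by linarith)

/-- Boundaries annihilate cycles of the same order under the Poincaré pairing. -/
theorem pairing_eq_zero_of_mem_B_of_mem_Z {r : ℕ} {a b a' b' : ℤ} (hQ : a + a' = M.Q)
    (hn : a + b + a' + b' = M.n) {x y : T} (hx : x ∈ M.B r a b) (hy : y ∈ M.Z r a' b') :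
    M.pairing x y = 0 := by
  obtain ⟨c, hc, rfl, hrel⟩ := hx
  obtain ⟨z, hz⟩ := hy
  have key : ∀ k ∈ Finset.range r, M.pairing (M.d k (c k)) y =
      ∑ l ∈ Finset.Ico 1 (k + 1), M.pairing (M.d (k - l) (c k)) (z l) := by
    intro k hk
    rw [M.pairing_d (k := a + b - 1) (hc k) hz.1 (by ring) (by linarith) (by linarith),
      hz.d_eq (Finset.mem_range.mp hk), map_sum, Finset.mul_sum]
    refine Finset.sum_congr rfl fun l hl => ?_
    simp only [Finset.mem_Ico] at hl
    have e : ((k - l : ℕ) : ℤ) = k - l := by omega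
    rw [M.pairing_d (k := a + b - 1) (hc k) (hz.2.1 l) (by ring) (by linarith) (by linarith)]
  rw [map_sum, LinearMap.sum_apply, Finset.sum_congr rfl key,
    Finset.sum_comm' (t' := Finset.Ico 1 r) (s' := fun l => Finset.Ico l r)]
  · refine Finset.sum_eq_zero fun l hl => ?_
    rw [← LinearMap.sum_apply, ← map_sum,
      hrel l (Finset.mem_Ico.mp hl).1 (Finset.mem_Ico.mp hl).2, map_zero, LinearMap.zero_apply]
  · intro k l
    simp only [Finset.mem_range, Finset.mem_Ico]
    omega

/-- The differential `Δ_r`, on representatives, is skew for the Poincaré pairing. -/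
theorem pairing_leading {r : ℕ} {a b a' b' k : ℤ} (hk : a + b = k) (hQ : a + a' + r = M.Q)
    (hn : a + b + a' + b' + 1 = M.n) {x y : T} {w z : ℕ → T} (hx : M.IsZWitness r a b x w)
    (hy : M.IsZWitness r a' b' y z) :
    M.pairing (M.leading r x w) y = -(-1 : ℝ) ^ k * M.pairing x (M.leading r y z) := by
  have h1 : ∀ i ∈ Finset.Ico 1 r, M.pairing (M.d (r - i) (w i)) y =
      -(-1 : ℝ) ^ k * ∑ l ∈ Finset.Ico 1 (r - i + 1), M.pairing (w i) (M.d (r - i - l) (z l)) := by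
    intro i hi
    simp only [Finset.mem_Ico] at hi
    have e : ((r - i : ℕ) : ℤ) = r - i := by omega
    rw [M.pairing_d (k := k) (hx.2.1 i) hy.1 (by linarith) (by linarith) (by linarith),
      hy.d_eq (by omega), map_sum]
  have h2 : ∀ l ∈ Finset.Ico 1 r, M.pairing x (M.d (r - l) (z l)) =
      ∑ i ∈ Finset.Ico 1 (r - l + 1), M.pairing (w i) (M.d (r - i - l) (z l)) := by
    intro l hl
    simp only [Finset.mem_Ico] at hl
    have e : ((r - l : ℕ) : ℤ) = r - l := by omega
    have h3 := M.pairing_d (k := k) (i := r - l) hx.1 (hy.2.1 l) (by linarith) (by linarith)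
      (by linarith)
    rw [hx.d_eq (by omega), map_sum, LinearMap.sum_apply] at h3
    have h4 : ∀ i ∈ Finset.Ico 1 (r - l + 1), M.pairing (M.d (r - l - i) (w i)) (z l) =
        -(-1 : ℝ) ^ k * M.pairing (w i) (M.d (r - i - l) (z l)) := by
      intro i hi
      simp only [Finset.mem_Ico] at hi
      have e : ((r - l - i : ℕ) : ℤ) = r - l - i := by omega
      rw [M.pairing_d (k := k) (hx.2.1 i) (hy.2.1 l) (by linarith) (by linarith) (by linarith),
        Nat.sub_right_comm]
    rw [Finset.sum_congr rfl h4, ← Finset.mul_sum] at h3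
    exact (mul_left_cancel₀ (by simp [zpow_ne_zero]) h3).symm
  rw [Multicomplex.leading, Multicomplex.leading, map_sub, map_sub, LinearMap.sub_apply, mul_sub,
    M.pairing_d (k := k) hx.1 hy.1 hk hQ hn, map_sum, map_sum, LinearMap.sum_apply,
    Finset.sum_congr rfl h1, Finset.sum_congr rfl h2, ← Finset.mul_sum]
  congr 2
  refine Finset.sum_comm' ?_
  intro i l
  simp only [Finset.mem_Ico]
  omega

/-- If the annihilator of `B_r` consists of cycles of order `r` and `B_r` is closed, then
conversely `B_r` contains the annihilator of these cycles: the component of `x` orthogonal to `B_r`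
has its Hodge dual in `Z_r`, so it is orthogonal to itself. -/
theorem mem_B_of_pairing_eq_zero_of_forall_mem_Z {r : ℕ} {a b a' b' : ℤ} (hQ : a + a' = M.Q)
    (hn : a + b + a' + b' = M.n) (hproj : (M.B r a b).HasOrthogonalProjection)
    (hZ : ∀ y ∈ M.C a' b', (∀ x ∈ M.B r a b, M.pairing x y = 0) → y ∈ M.Z r a' b')
    {x : T} (hx : x ∈ M.C a b) (h : ∀ y ∈ M.Z r a' b', M.pairing x y = 0) :
    x ∈ M.B r a b := by
  obtain ⟨β, hβ, x', hx', rfl⟩ := (M.B r a b).exists_add_mem_mem_orthogonal x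
  have hx'C : x' ∈ M.C a b := by
    have := Submodule.sub_mem _ hx (M.B_le r a b hβ)
    rwa [add_sub_cancel_left] at this
  have hz : M.hodge x' ∈ M.Z r a' b' := by
    refine hZ _ (M.hodge_mem_of_eq hx'C hQ hn) fun v hv => ?_
    rw [M.pairing_hodge (M.B_le r a b hv) hx'C]
    exact (Submodule.mem_orthogonal _ _).mp hx' v hv
  have h0 := h _ hz
  rw [M.pairing_hodge hx hx'C, inner_add_left, (Submodule.mem_orthogonal _ _).mp hx' β hβ,
    zero_add, inner_self_eq_zero] at h0
  rw [h0, add_zero]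
  exact hβ

/-- If all `B_r` are closed, the annihilator of `B_r` under the Poincaré pairing is `Z_r` in the
complementary bidegree. The induction step shows that the obstruction to extending a witness
annihilates `Z_r`, so it lies in `B_r` and the witness can be corrected. -/
theorem mem_Z_of_forall_pairing_B (hM : M.BClosed) {r : ℕ} (hr : 1 ≤ r) :
    ∀ {a b a' b' : ℤ}, a + a' = M.Q → a + b + a' + b' = M.n → ∀ y ∈ M.C a' b',
      (∀ x ∈ M.B r a b, M.pairing x y = 0) → y ∈ M.Z r a' b' := by
  induction r, hr using Nat.le_induction with
  | base =>
    intro a b a' b' hQ hn y hy h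
    rw [M.mem_Z_one_iff]
    refine ⟨hy, ?_⟩
    have hd : M.d 0 y ∈ M.C a' (b' + 1) := M.d_mem_of_eq hy (by simp) (by simp)
    have hs : M.hodge (M.d 0 y) ∈ M.C a (b - 1) :=
      M.hodge_mem_of_eq hd (by linarith) (by linarith)
    have h0 := h _ (M.mem_B_one_iff.mpr ⟨_, hs, rfl⟩)
    rw [M.pairing_d (k := a + (b - 1)) hs hy rfl (by simpa using hQ) (by linarith),
      M.pairing_comm hs hd, M.pairing_hodge hd hd] at h0
    simpa [zpow_ne_zero] using h0
  | succ r hr ih =>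
    intro a b a' b' hQ hn y hy h
    obtain ⟨z, hz⟩ := ih hQ hn y hy fun x hx => h x (M.B_le_succ r a b hx)
    refine M.mem_Z_succ_of_leading_mem_B hr hz ?_
    refine M.mem_B_of_pairing_eq_zero_of_forall_mem_Z (a' := a - r) (b' := b - 1 + r)
      (by linarith) (by linarith) (hM r _ _ hr) (ih (by linarith) (by linarith))
      hz.leading_mem_C ?_
    rintro ζ ⟨w, hw⟩
    rw [M.pairing_comm hz.leading_mem_C hw.1]
    have h1 := M.pairing_leading rfl (by linarith) (by linarith) hw hz
    have hB := hw.leading_mem_B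
    rw [show a - (r : ℤ) + r = a by ring, show b - 1 + (r : ℤ) + 1 - r = b by ring] at hB
    rw [h _ hB] at h1
    have h2 : M.pairing ζ (M.leading r y z) = 0 := by simpa [zpow_ne_zero] using h1.symm
    rw [h2, mul_zero]

/-- Orthogonality to `B_r` is membership of the Hodge dual in `Z_r`. -/
theorem mem_orthogonal_B_iff (hM : M.BClosed) {r : ℕ} (hr : 1 ≤ r) {a b a' b' : ℤ}
    (hQ : a + a' = M.Q) (hn : a + b + a' + b' = M.n) {x : T} (hx : x ∈ M.C a b) :
    x ∈ (M.B r a b)ᗮ ↔ M.hodge x ∈ M.Z r a' b' := by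
  rw [Submodule.mem_orthogonal]
  refine ⟨fun h => M.mem_Z_of_forall_pairing_B hM hr hQ hn _ (M.hodge_mem_of_eq hx hQ hn)
    fun v hv => ?_, fun h v hv => ?_⟩
  · rw [M.pairing_hodge (M.B_le r a b hv) hx]
    exact h v hv
  · rw [← M.pairing_hodge (M.B_le r a b hv) hx]
    exact M.pairing_eq_zero_of_mem_B_of_mem_Z hQ hn hv h

theorem hodge_hodge_mem_iff {a b : ℤ} {x : T} (hx : x ∈ M.C a b) (S : Submodule ℝ T) :
    M.hodge (M.hodge x) ∈ S ↔ x ∈ S := by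
  rw [M.hodge_hodge a b x hx]
  exact S.smul_mem_iff (by simp [zpow_ne_zero])

theorem mem_Z_iff_hodge_mem_orthogonal_B (hM : M.BClosed) {r : ℕ} (hr : 1 ≤ r) {a b a' b' : ℤ}
    (hQ : a + a' = M.Q) (hn : a + b + a' + b' = M.n) {x : T} (hx : x ∈ M.C a b) :
    x ∈ M.Z r a b ↔ M.hodge x ∈ (M.B r a' b')ᗮ := by
  rw [M.mem_orthogonal_B_iff hM hr (a' := a) (b' := b) (by linarith) (by linarith)
    (M.hodge_mem_of_eq hx hQ hn), M.hodge_hodge_mem_iff hx]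

theorem hodge_mem_of_mem_Z_inf (hM : M.BClosed) {r₁ r₂ : ℕ} (h₁ : 1 ≤ r₁) (h₂ : 1 ≤ r₂)
    {a b a' b' : ℤ} (hQ : a + a' = M.Q) (hn : a + b + a' + b' = M.n) {x : T}
    (hx : x ∈ M.Z r₁ a b ⊓ (M.B r₂ a b)ᗮ) : M.hodge x ∈ M.Z r₂ a' b' ⊓ (M.B r₁ a' b')ᗮ := by
  have hC := M.Z_le _ _ _ hx.1
  exact ⟨(M.mem_orthogonal_B_iff hM h₂ hQ hn hC).mp hx.2,
    (M.mem_Z_iff_hodge_mem_orthogonal_B hM h₁ hQ hn hC).mp hx.1⟩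

/-- The Hodge star exchanges the two orders of `Z_{r₁} ∩ (B_{r₂})ᗮ`. -/
theorem map_hodge_Z_inf (hM : M.BClosed) {r₁ r₂ : ℕ} (h₁ : 1 ≤ r₁) (h₂ : 1 ≤ r₂)
    {a b a' b' : ℤ} (hQ : a + a' = M.Q) (hn : a + b + a' + b' = M.n) :
    (M.Z r₁ a b ⊓ (M.B r₂ a b)ᗮ).map M.hodge = M.Z r₂ a' b' ⊓ (M.B r₁ a' b')ᗮ := by
  apply le_antisymm
  · rintro _ ⟨x, hx, rfl⟩
    exact M.hodge_mem_of_mem_Z_inf hM h₁ h₂ hQ hn hx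
  · intro y hy
    have hyC := M.Z_le _ _ _ hy.1
    rw [← M.hodge_hodge_mem_iff hyC]
    exact Submodule.mem_map_of_mem
      (M.hodge_mem_of_mem_Z_inf hM h₂ h₁ (by linarith) (by linarith) hy)

end HodgeMulticomplex

/-! ### Partial inverse, Rumin forms and the operators of the Rumin complex -/

namespace Multicomplex

variable {T : Type u} [NormedAddCommGroup T] [InnerProductSpace ℝ T] (M : Multicomplex T)

theorem d_zero_d_zero (x : T) : M.d 0 (M.d 0 x) = 0 := by
  have h := M.d_comp 0
  simp only [zero_add, Finset.sum_range_one, Nat.sub_self] at h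
  exact LinearMap.congr_fun h x

theorem mem_orthogonal_range_iff {a b : ℤ} {x : T} (hx : x ∈ M.C a b) :
    x ∈ (LinearMap.range (M.d 0))ᗮ ↔ x ∈ (M.B 1 a b)ᗮ := by
  refine ⟨fun h => Submodule.orthogonal_le ?_ h, fun h => ?_⟩
  · intro y hy
    obtain ⟨c, -, rfl⟩ := M.mem_B_one_iff.mp hy
    exact ⟨c, rfl⟩
  · rw [Submodule.mem_orthogonal]
    rintro _ ⟨t, rfl⟩
    induction t using M.homogeneous_induction with
    | hom a' b' t ht =>
      have hd : M.d 0 t ∈ M.C a' (b' + 1) := M.d_mem_of_eq ht (by simp) (by simp)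
      by_cases hab : (a', b' + 1) = (a, b)
      · simp only [Prod.mk.injEq] at hab
        obtain ⟨rfl, rfl⟩ := hab
        exact (Submodule.mem_orthogonal _ _).mp h _
          (M.mem_B_one_iff.mpr ⟨t, M.mem_C_of_eq ht rfl (by ring), rfl⟩)
      · exact M.inner_eq_zero_of_ne hab hd hx
    | add s t hs ht => rw [map_add, inner_add_left, hs, ht, add_zero]

theorem rumin_eq_E (p k : ℤ) : M.rumin p k = M.E 1 1 p k := by
  ext x
  constructor
  · rintro ⟨⟨h1, h2⟩, h3⟩
    exact ⟨M.mem_Z_one_iff.mpr ⟨h3, h1⟩, (M.mem_orthogonal_range_iff h3).mp h2⟩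
  · rintro ⟨h1, h2⟩
    obtain ⟨h3, h4⟩ := M.mem_Z_one_iff.mp h1
    exact ⟨⟨h4, (M.mem_orthogonal_range_iff h3).mpr h2⟩, h3⟩

variable {M} in
/-- The values of a partial inverse are determined by the two orthogonality conditions. -/
theorem partialInverse_unique {y u v : T} (hu : u ∈ (LinearMap.ker (M.d 0))ᗮ)
    (hu' : y - M.d 0 u ∈ (LinearMap.range (M.d 0))ᗮ) (hv : v ∈ (LinearMap.ker (M.d 0))ᗮ)
    (hv' : y - M.d 0 v ∈ (LinearMap.range (M.d 0))ᗮ) : u = v := by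
  have h1 : M.d 0 (u - v) ∈ (LinearMap.range (M.d 0))ᗮ := by
    have := Submodule.sub_mem _ hv' hu'
    rwa [sub_sub_sub_cancel_left, ← map_sub] at this
  have h2 : M.d 0 (u - v) = 0 :=
    inner_self_eq_zero.mp ((Submodule.mem_orthogonal _ _).mp h1 _ ⟨u - v, rfl⟩)
  have h3 : u - v ∈ (LinearMap.ker (M.d 0))ᗮ := Submodule.sub_mem _ hu hv
  exact sub_eq_zero.mp (inner_self_eq_zero.mp ((Submodule.mem_orthogonal _ _).mp h3 _ h2))

theorem del_apply (r : ℕ) (x : T) :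
    M.del r x = M.d r x - ∑ j ∈ Finset.Ico 1 r, M.d (r - j) (M.d0inv (M.del j x)) := by
  rw [del, LinearMap.sub_apply,
    Finset.sum_attach (Finset.Ico 1 r) fun j => M.d (r - j) ∘ₗ M.d0inv ∘ₗ M.del j,
    LinearMap.sum_apply]
  rfl

/-- The mirror image of the recursion that defines `∂_r`: with `D = ∑_{r ≥ 1} d_r` and
`G = d_0⁻¹`, both expand `(1 + D G)⁻¹ D = D (1 + G D)⁻¹`. -/
theorem del_apply_right (r : ℕ) (x : T) :
    M.del r x = M.d r x - ∑ j ∈ Finset.Ico 1 r, M.del j (M.d0inv (M.d (r - j) x)) := by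
  induction r using Nat.strong_induction_on generalizing x with
  | _ r ih =>
    have hL : ∀ j ∈ Finset.Ico 1 r, M.d (r - j) (M.d0inv (M.del j x)) =
        M.d (r - j) (M.d0inv (M.d j x)) -
          ∑ i ∈ Finset.Ico 1 j, M.d (r - j) (M.d0inv (M.del i (M.d0inv (M.d (j - i) x)))) := by
      intro j hj
      rw [ih j (Finset.mem_Ico.mp hj).2 x, map_sub, map_sub, map_sum, map_sum]
    have hR : ∀ j ∈ Finset.Ico 1 r, M.del j (M.d0inv (M.d (r - j) x)) =
        M.d j (M.d0inv (M.d (r - j) x)) -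
          ∑ i ∈ Finset.Ico 1 j, M.d (j - i) (M.d0inv (M.del i (M.d0inv (M.d (r - j) x)))) :=
      fun j _ => M.del_apply j _
    rw [M.del_apply r x, Finset.sum_congr rfl hL, Finset.sum_congr rfl hR,
      Finset.sum_sub_distrib, Finset.sum_sub_distrib]
    congr 2
    · refine Finset.sum_nbij' (fun j => r - j) (fun j => r - j) ?_ ?_ ?_ ?_ ?_
      iterate 4
        intro i hi
        simp only [Finset.mem_Ico] at hi ⊢
        omega
      intro i hi
      simp only [Finset.mem_Ico] at hi
      rw [Nat.sub_sub_self (by omega)]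
    · have swap : ∀ f : ℕ → ℕ → T, ∑ j ∈ Finset.Ico 1 r, ∑ i ∈ Finset.Ico 1 j, f j i =
          ∑ i ∈ Finset.Ico 1 r, ∑ j ∈ Finset.Ico (i + 1) r, f j i := by
        intro f
        refine Finset.sum_comm' fun j i => ?_
        simp only [Finset.mem_Ico]
        omega
      rw [swap, swap]
      refine Finset.sum_congr rfl fun i hi => ?_
      refine Finset.sum_nbij' (fun j => r + i - j) (fun j => r + i - j) ?_ ?_ ?_ ?_ ?_
      iterate 4
        intro j hj
        simp only [Finset.mem_Ico] at hj ⊢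
        omega
      intro j hj
      simp only [Finset.mem_Ico] at hj
      rw [show r + i - j - i = r - j by omega, show r - (r + i - j) = j - i by omega]

theorem dc_apply (r : ℕ) (x : T) :
    M.dc r x = M.del r x - M.d0inv (M.d 0 (M.del r x)) - M.d 0 (M.d0inv (M.del r x)) := rfl

variable {M}

theorem d0_dc (hG : M.IsPartialInverse M.d0inv) (r : ℕ) (x : T) : M.d 0 (M.dc r x) = 0 := by
  have h := (hG (M.d 0 (M.del r x))).2
  rw [← map_sub] at h
  have h0 := inner_self_eq_zero.mp ((Submodule.mem_orthogonal _ _).mp h _ ⟨_, rfl⟩)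
  rw [dc_apply, map_sub, d_zero_d_zero, sub_zero, h0]

theorem ker_orthogonal_le (M : Multicomplex T) :
    (LinearMap.ker (M.d 0))ᗮ ≤ (LinearMap.range (M.d 0))ᗮ := by
  refine Submodule.orthogonal_le ?_
  rintro _ ⟨t, rfl⟩
  exact M.d_zero_d_zero t

theorem dc_mem_orthogonal_range (hG : M.IsPartialInverse M.d0inv) (r : ℕ) (x : T) :
    M.dc r x ∈ (LinearMap.range (M.d 0))ᗮ := by
  rw [dc_apply, sub_right_comm]
  exact Submodule.sub_mem _ (hG _).2 (M.ker_orthogonal_le (hG _).1)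

/-- `d_c^r x` is the orthogonal projection of `∂_r x` to the Rumin forms. -/
theorem inner_dc (hG : M.IsPartialInverse M.d0inv) (r : ℕ) (x : T) {p k : ℤ} {y : T}
    (hy : y ∈ M.rumin p k) : inner ℝ (M.dc r x) y = inner ℝ (M.del r x) y := by
  obtain ⟨⟨h1, h2⟩, -⟩ := hy
  rw [dc_apply, inner_sub_left, inner_sub_left, (Submodule.mem_orthogonal _ _).mp h2 _ ⟨_, rfl⟩,
    real_inner_comm, real_inner_comm y (M.d0inv _),
    (Submodule.mem_orthogonal _ _).mp (hG _).1 y h1, sub_zero, sub_zero, real_inner_comm]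

/-- `Δ_j` has a value on every element of `Z_j` if `B_j` is closed. -/
theorem isDelta_Delta (hM : M.BClosed) {j : ℕ} (hj : 1 ≤ j) {p k : ℤ} {α : T}
    (hα : α ∈ M.Z j p (k - p)) : M.IsDelta j p k α (M.Delta j p k α) := by
  have h : ∃ β, M.IsDelta j p k α β := by
    obtain ⟨z, hz⟩ := hα
    have := hM j (p + j) (k + 1 - p - j) hj
    obtain ⟨v, hv, β, hβ, e⟩ := (M.B j (p + j) (k + 1 - p - j)).exists_add_mem_mem_orthogonal
      (M.leading j α z)
    refine ⟨β, z, hz, hβ, ?_⟩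
    have e' : M.leading j α z - β = v := by rw [e, add_sub_cancel_right]
    rw [← e'] at hv
    exact hv
  rw [Delta, dif_pos h]
  exact h.choose_spec

end Multicomplex

/-! ### Hodge duality of spectral complexes -/

namespace HodgeMulticomplex

variable {T : Type u} [NormedAddCommGroup T] [InnerProductSpace ℝ T] (M : HodgeMulticomplex T)

/-- Up to sign, `⋆ d_0 v` is the adjoint of `d_0` applied to `⋆ v`. This adjoint relation is
checked on homogeneous test elements `t`; in other bidegrees both sides vanish. -/
theorem hodge_d0_mem_ker_orthogonal {a b : ℤ} {v : T} (hv : v ∈ M.C a b) :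
    M.hodge (M.d 0 v) ∈ (LinearMap.ker (M.d 0))ᗮ := by
  rw [Submodule.mem_orthogonal]
  have hd : M.d 0 v ∈ M.C a (b + 1) := M.d_mem_of_eq hv (by simp) (by simp)
  have hsd : M.hodge (M.d 0 v) ∈ M.C (M.Q - a) (M.n - M.Q - (b + 1)) := M.hodge_mem _ _ _ hd
  have hs : M.hodge v ∈ M.C (M.Q - a) (M.n - M.Q - b) := M.hodge_mem _ _ _ hv
  have key : ∀ t : T, (-1 : ℝ) ^ ((a + b) * (M.n - (a + b))) *
      (-(-1 : ℝ) ^ (M.n - a - b - 1) * inner ℝ t (M.hodge (M.d 0 v))) =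
      (-1 : ℝ) ^ ((a + (b + 1)) * (M.n - (a + (b + 1)))) * inner ℝ (M.d 0 t) (M.hodge v) := by
    intro t
    induction t using M.homogeneous_induction with
    | hom a' b' t ht =>
      have hdt : M.d 0 t ∈ M.C a' (b' + 1) := M.d_mem_of_eq ht (by simp) (by simp)
      by_cases hab : (a', b') = (M.Q - a, M.n - M.Q - (b + 1))
      · simp only [Prod.mk.injEq] at hab
        obtain ⟨rfl, rfl⟩ := hab
        rw [← M.pairing_hodge ht hsd, ← M.pairing_hodge hdt (M.mem_C_of_eq hs rfl (by ring)),
          M.hodge_hodge _ _ _ hv, M.hodge_hodge _ _ _ hd, map_smul, map_smul, smul_eq_mul,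
          smul_eq_mul, M.pairing_d (k := M.n - a - b - 1) ht hv (by ring) (by simp) (by ring)]
        ring
      · rw [M.inner_eq_zero_of_ne hab ht hsd, M.inner_eq_zero_of_ne (fun h => hab ?_) hdt hs,
          mul_zero, mul_zero, mul_zero]
        simp only [Prod.mk.injEq] at h ⊢
        exact ⟨h.1, by linarith [h.2]⟩
    | add s t hs ht => rw [map_add, inner_add_left, inner_add_left, mul_add, mul_add, mul_add,
        hs, ht]
  intro t ht
  have h := key t
  rw [LinearMap.mem_ker.mp ht, inner_zero_left, mul_zero] at h
  simpa [zpow_ne_zero] using h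

/-- On homogeneous elements the partial inverse of `d_0` exists: closedness of the image of `d_0`
gives the projection to this image, and, by Hodge duality, the projection to the kernel. -/
theorem exists_partialInverse_apply (hM : M.BClosed) {a b : ℤ} {x : T} (hx : x ∈ M.C a b) :
    ∃ u ∈ M.C a (b - 1), u ∈ (LinearMap.ker (M.d 0))ᗮ ∧
      x - M.d 0 u ∈ (LinearMap.range (M.d 0))ᗮ := by
  have := hM 1 a b le_rfl
  obtain ⟨β, hβ, x', hx', rfl⟩ := (M.B 1 a b).exists_add_mem_mem_orthogonal x
  have hx'C : x' ∈ M.C a b := by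
    have := Submodule.sub_mem _ hx (M.B_le _ a b hβ)
    rwa [add_sub_cancel_left] at this
  obtain ⟨c, hc, rfl⟩ := M.mem_B_one_iff.mp hβ
  have hsc : M.hodge c ∈ M.C (M.Q - a) (M.n - M.Q - (b - 1)) := M.hodge_mem _ _ _ hc
  have := hM 1 (M.Q - a) (M.n - M.Q - (b - 1)) le_rfl
  obtain ⟨β', hβ', e, he, hsum⟩ :=
    (M.B 1 (M.Q - a) (M.n - M.Q - (b - 1))).exists_add_mem_mem_orthogonal (M.hodge c)
  have heC : e ∈ M.C (M.Q - a) (M.n - M.Q - (b - 1)) := by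
    have := Submodule.sub_mem _ hsc (M.B_le _ _ _ hβ')
    rwa [hsum, add_sub_cancel_left] at this
  obtain ⟨v, hv, rfl⟩ := M.mem_B_one_iff.mp hβ'
  have hdv : M.d 0 v ∈ M.C (M.Q - a) (M.n - M.Q - (b - 1)) := M.B_le _ _ _ hβ'
  have hde : M.d 0 (M.hodge e) = 0 :=
    (M.mem_Z_one_iff.mp ((M.mem_orthogonal_B_iff hM le_rfl (a' := a) (b' := b - 1) (by ring)
      (by ring) heC).mp he)).2
  -- `c = ± ⋆⋆c = ± (⋆ d_0 v + ⋆ e)`, with the second term in the kernel of `d_0`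
  set ε : ℝ := (-1 : ℝ) ^ ((a + (b - 1)) * (M.n - (a + (b - 1)))) with hε
  have hdu : M.d 0 (ε • M.hodge (M.d 0 v)) = M.d 0 c := by
    have h1 : M.d 0 (M.hodge (M.hodge c)) = ε • M.d 0 c := by
      rw [M.hodge_hodge _ _ _ hc, map_smul]
    rw [hsum, map_add, map_add, hde, add_zero] at h1
    rw [map_smul, h1, smul_smul, hε, neg_one_zpow_mul_self, one_smul]
  refine ⟨ε • M.hodge (M.d 0 v), Submodule.smul_mem _ _ ?_, Submodule.smul_mem _ _
    (M.hodge_d0_mem_ker_orthogonal hv), ?_⟩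
  · exact M.hodge_mem_of_eq hdv (by ring) (by ring)
  · rw [hdu, add_sub_cancel_left]
    exact (M.mem_orthogonal_range_iff hx'C).mpr hx'

theorem isPartialInverse_d0inv (hM : M.BClosed) : M.IsPartialInverse M.d0inv := by
  have hex : ∀ y : T, ∃ u, u ∈ (LinearMap.ker (M.d 0))ᗮ ∧
      y - M.d 0 u ∈ (LinearMap.range (M.d 0))ᗮ := by
    intro y
    induction y using M.homogeneous_induction with
    | hom a b y hy =>
      obtain ⟨u, -, h⟩ := M.exists_partialInverse_apply hM hy
      exact ⟨u, h⟩
    | add x y hx hy =>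
      obtain ⟨u, hu, hu'⟩ := hx
      obtain ⟨v, hv, hv'⟩ := hy
      refine ⟨u + v, Submodule.add_mem _ hu hv, ?_⟩
      rw [map_add, add_sub_add_comm]
      exact Submodule.add_mem _ hu' hv'
  choose g hg hg' using hex
  let G : T →ₗ[ℝ] T :=
    { toFun := g
      map_add' := fun x y => Multicomplex.partialInverse_unique (hg _) (hg' _)
        (Submodule.add_mem _ (hg x) (hg y)) (by
          rw [map_add, add_sub_add_comm]
          exact Submodule.add_mem _ (hg' x) (hg' y))
      map_smul' := fun c x => Multicomplex.partialInverse_unique (hg _) (hg' _)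
        (Submodule.smul_mem _ c (hg x)) (by
          rw [map_smul, RingHom.id_apply, ← smul_sub]
          exact Submodule.smul_mem _ c (hg' x)) }
  have h : ∃ G, M.IsPartialInverse G := ⟨G, fun y => ⟨hg y, hg' y⟩⟩
  rw [Multicomplex.d0inv, dif_pos h]
  exact h.choose_spec

theorem d0inv_mem (hM : M.BClosed) {a b a' b' : ℤ} {x : T} (hx : x ∈ M.C a b) (ha : a' = a)
    (hb : b' = b - 1) : M.d0inv x ∈ M.C a' b' := by
  subst ha hb
  obtain ⟨u, hu, h1, h2⟩ := M.exists_partialInverse_apply hM hx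
  have h := M.isPartialInverse_d0inv hM x
  rwa [Multicomplex.partialInverse_unique h.1 h.2 h1 h2]

theorem pairing_eq_zero_of_mem_orthogonal (hM : M.BClosed) {a b a' b' : ℤ} (hQ : a + a' = M.Q)
    (hn : a + b + a' + b' = M.n) {u v : T} (hu : u ∈ M.C a b) (hv : v ∈ M.C a' b')
    (hu' : u ∈ (LinearMap.ker (M.d 0))ᗮ) (hv' : v ∈ (LinearMap.range (M.d 0))ᗮ) :
    M.pairing u v = 0 := by
  have hz : M.hodge v ∈ M.Z 1 a b := (M.mem_orthogonal_B_iff hM le_rfl (by linarith)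
    (by linarith) hv).mp ((M.mem_orthogonal_range_iff hv).mp hv')
  obtain ⟨hC, hd⟩ := M.mem_Z_one_iff.mp hz
  have h0 := (Submodule.mem_orthogonal _ _).mp hu' _ hd
  rw [real_inner_comm, ← M.pairing_hodge hu hC, M.hodge_hodge _ _ _ hv] at h0
  simpa [zpow_ne_zero] using h0

/-- The partial inverse of `d_0` is graded symmetric for the Poincaré pairing. -/
theorem pairing_d0inv (hM : M.BClosed) {a b a' b' k : ℤ} (hk : a + b = k) (hQ : a + a' = M.Q)
    (hn : a + b + a' + b' = M.n + 1) {x y : T} (hx : x ∈ M.C a b) (hy : y ∈ M.C a' b') :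
    M.pairing (M.d0inv x) y = (-1 : ℝ) ^ k * M.pairing x (M.d0inv y) := by
  obtain ⟨hu1, hu2⟩ := M.isPartialInverse_d0inv hM x
  obtain ⟨hv1, hv2⟩ := M.isPartialInverse_d0inv hM y
  have hu : M.d0inv x ∈ M.C a (b - 1) := M.d0inv_mem hM hx rfl rfl
  have hv : M.d0inv y ∈ M.C a' (b' - 1) := M.d0inv_mem hM hy rfl rfl
  have hxr : x - M.d 0 (M.d0inv x) ∈ M.C a b :=
    Submodule.sub_mem _ hx (M.d_mem_of_eq hu (by simp) (by simp))
  have hyr : y - M.d 0 (M.d0inv y) ∈ M.C a' b' :=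
    Submodule.sub_mem _ hy (M.d_mem_of_eq hv (by simp) (by simp))
  have h1 := M.pairing_eq_zero_of_mem_orthogonal hM hQ (by linarith) hu hyr hu1 hv2
  have h2 := M.pairing_eq_zero_of_mem_orthogonal hM (by linarith) (by linarith) hv hxr hv1 hu2
  have h3 : M.pairing (x - M.d 0 (M.d0inv x)) (M.d0inv y) = 0 := by
    rw [M.pairing_comm hxr hv, h2, mul_zero]
  have h4 := M.pairing_d (i := 0) (k := k - 1) hu hv (by linarith) (by simpa using hQ)
    (by linarith)
  rw [map_sub, sub_eq_zero] at h1
  rw [map_sub, LinearMap.sub_apply, sub_eq_zero] at h3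
  rw [h1, h3, h4, ← mul_assoc, zpow_sub_one₀ (by norm_num)]
  have := neg_one_zpow_mul_self k
  linear_combination (-M.pairing (M.d0inv x) (M.d 0 (M.d0inv y))) * this

theorem del_mem (hM : M.BClosed) {r : ℕ} {a b a' b' : ℤ} {x : T} (hx : x ∈ M.C a b)
    (ha : a' = a + r) (hb : b' = b + 1 - r) : M.del r x ∈ M.C a' b' := by
  induction r using Nat.strong_induction_on generalizing a' b' with
  | _ r ih =>
    rw [M.del_apply]
    refine Submodule.sub_mem _ (M.d_mem_of_eq hx ha hb) (Submodule.sum_mem _ fun j hj => ?_)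
    simp only [Finset.mem_Ico] at hj
    have e : ((r - j : ℕ) : ℤ) = r - j := by omega
    exact M.d_mem_of_eq (M.d0inv_mem hM (ih j hj.2 rfl rfl) rfl rfl) (by linarith)
      (by linarith)

/-- The operators `∂_r` are skew for the Poincaré pairing. -/
theorem pairing_del (hM : M.BClosed) {r : ℕ} {a b a' b' k : ℤ} (hk : a + b = k)
    (hQ : a + a' + r = M.Q) (hn : a + b + a' + b' + 1 = M.n) {x y : T} (hx : x ∈ M.C a b)
    (hy : y ∈ M.C a' b') :
    M.pairing (M.del r x) y = -(-1 : ℝ) ^ k * M.pairing x (M.del r y) := by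
  induction r using Nat.strong_induction_on generalizing a' b' y with
  | _ r ih =>
    have h : ∀ j ∈ Finset.Ico 1 r, M.pairing (M.d (r - j) (M.d0inv (M.del j x))) y =
        -(-1 : ℝ) ^ k * M.pairing x (M.del j (M.d0inv (M.d (r - j) y))) := by
      intro j hj
      simp only [Finset.mem_Ico] at hj
      have e : ((r - j : ℕ) : ℤ) = r - j := by omega
      have hdx : M.del j x ∈ M.C (a + j) (b + 1 - j) := M.del_mem hM hx rfl rfl
      have hdy : M.d (r - j) y ∈ M.C (a' + (r - j)) (b' + 1 - (r - j)) :=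
        M.d_mem_of_eq hy (by linarith) (by linarith)
      rw [M.pairing_d (k := k) (M.d0inv_mem hM hdx rfl rfl) hy (by linarith) (by linarith)
          (by linarith),
        M.pairing_d0inv hM (k := k + 1) (by linarith) (by linarith) (by linarith) hdx hdy,
        ih j hj.2 (by linarith) (by linarith) (M.d0inv_mem hM hdy rfl rfl),
        zpow_add_one₀ (by norm_num)]
      have := neg_one_zpow_mul_self k
      linear_combination
        (-(-1 : ℝ) ^ k * M.pairing x (M.del j (M.d0inv (M.d (r - j) y)))) * this
    rw [M.del_apply, M.del_apply_right r y, map_sub, map_sub, LinearMap.sub_apply, map_sum,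
      LinearMap.sum_apply, map_sum, Finset.sum_congr rfl h, M.pairing_d (k := k) hx hy hk hQ hn,
      mul_sub, Finset.mul_sum]

theorem hodge_mem_rumin (hM : M.BClosed) {p k p' k' : ℤ} (hp : p + p' = M.Q) (hk : k + k' = M.n)
    {x : T} (hx : x ∈ M.rumin p k) : M.hodge x ∈ M.rumin p' k' := by
  rw [Multicomplex.rumin_eq_E] at hx ⊢
  exact M.hodge_mem_of_mem_Z_inf hM le_rfl le_rfl hp (by linarith) hx

/-- Up to sign, the adjoint of `d_c^j` on Rumin forms is `⋆ d_c^j ⋆`; so the two are non-zero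
simultaneously. -/
theorem mem_I_dual (hM : M.BClosed) {j : ℕ} {p k p' k' : ℤ} (hp : p + p' + j = M.Q)
    (hk : k + k' + 1 = M.n) (h : j ∈ M.I p k) : j ∈ M.I p' k' := by
  obtain ⟨hj, x, hx, hne⟩ := h
  have hG := M.isPartialInverse_d0inv hM
  have hxC : x ∈ M.C p (k - p) := hx.2
  have hdel : M.del j x ∈ M.C (p + j) (k + 1 - (p + j)) := M.del_mem hM hxC rfl (by ring)
  have hdc : M.dc j x ∈ M.rumin (p + j) (k + 1) := by
    refine ⟨⟨Multicomplex.d0_dc hG j x, Multicomplex.dc_mem_orthogonal_range hG j x⟩, ?_⟩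
    rw [Multicomplex.dc_apply]
    refine Submodule.sub_mem _ (Submodule.sub_mem _ hdel ?_) ?_
    · exact M.d0inv_mem hM (M.d_mem_of_eq hdel rfl rfl) (by simp) (by simp)
    · exact M.d_mem_of_eq (M.d0inv_mem hM hdel rfl rfl) (by simp) (by simp)
  have hs : M.hodge (M.dc j x) ∈ M.rumin p' k' :=
    M.hodge_mem_rumin hM (by linarith) (by linarith) hdc
  have hsx : M.hodge x ∈ M.rumin (p' + j) (k' + 1) :=
    M.hodge_mem_rumin hM (by linarith) (by linarith) hx
  refine ⟨hj, _, hs, fun h0 => hne ?_⟩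
  have h1 : inner ℝ (M.del j (M.hodge (M.dc j x))) (M.hodge x) = 0 := by
    rw [← Multicomplex.inner_dc hG j _ hsx, h0, inner_zero_left]
  have hdel' : M.del j (M.hodge (M.dc j x)) ∈ M.C (p' + j) (k' + 1 - (p' + j)) :=
    M.del_mem hM hs.2 rfl (by ring)
  rw [← M.pairing_hodge hdel' hsx.2, M.hodge_hodge _ _ _ hxC, map_smul, smul_eq_mul,
    M.pairing_comm hdel' hxC, mul_eq_zero, mul_eq_zero] at h1
  have h2 : M.pairing x (M.del j (M.hodge (M.dc j x))) = 0 := by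
    simpa [zpow_ne_zero] using h1
  have h3 := M.pairing_del hM (r := j) (k := k) (by ring) (by linarith) (by linarith) hxC hs.2
  rw [h2, mul_zero, M.pairing_hodge hdel hdc.2, ← Multicomplex.inner_dc hG j x hdc] at h3
  exact inner_self_eq_zero.mp h3

/-- The Hodge dual of a spectral complex. -/
def dualSpectralComplex (hM : M.BClosed) (X : M.SpectralComplex) : M.SpectralComplex where
  supp := {k | M.n - k ∈ X.supp}
  wt k := M.Q - X.wt (M.n - k)
  jump k := X.jump (M.n - k - 1)
  supp_nonempty := by
    obtain ⟨k, hk⟩ := X.supp_nonempty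
    exact ⟨M.n - k, by simpa using hk⟩
  supp_ordConnected := ⟨fun x hx y hy z hz =>
    X.supp_ordConnected.out hy hx ⟨by linarith [hz.2], by linarith [hz.1]⟩⟩
  jump_pos k := X.jump_pos _
  rumin_ne_bot k hk := by
    obtain ⟨x, hx, h0⟩ := (Submodule.ne_bot_iff _).mp (X.rumin_ne_bot _ hk)
    refine (Submodule.ne_bot_iff _).mpr
      ⟨M.hodge x, M.hodge_mem_rumin hM (by ring) (by ring) hx, fun h => h0 ?_⟩
    have h1 := (M.hodge_hodge_mem_iff hx.2 ⊥).mp (by simp [h])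
    simpa using h1
  wt_succ k hk hk1 := by
    have e : M.n - k = M.n - (k + 1) + 1 := by ring
    have h := X.wt_succ (M.n - (k + 1)) hk1 (e ▸ hk)
    rw [← e] at h
    rw [h, show M.n - k - 1 = M.n - (k + 1) by ring]
    ring
  jump_mem k hk hk1 := by
    have e : M.n - k = M.n - (k + 1) + 1 := by ring
    have h := X.wt_succ (M.n - (k + 1)) hk1 (e ▸ hk)
    have h2 := X.jump_mem (M.n - (k + 1)) hk1 (e ▸ hk)
    rw [← e] at h
    rw [show M.n - k - 1 = M.n - (k + 1) by ring]
    exact M.mem_I_dual hM (by rw [h]; ring) (by ring) h2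
  right_end k hk hk1 := by
    refine Set.eq_empty_iff_forall_notMem.mpr fun l hl => ?_
    refine X.left_end (M.n - k) hk (fun h => hk1 ?_) l (M.mem_I_dual hM (by ring) (by ring) hl)
    rw [Set.mem_ofPred_eq, show M.n - (k + 1) = M.n - k - 1 by ring]
    exact h
  left_end k hk hk1 l hl := by
    have h : l ∈ M.I (X.wt (M.n - k)) (M.n - k) := M.mem_I_dual hM (by ring) (by ring) hl
    rw [X.right_end (M.n - k) hk fun h => hk1 ?_] at h
    · exact h
    · rw [Set.mem_ofPred_eq, show M.n - (k - 1) = M.n - k + 1 by ring]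
      exact h

theorem map_hodge_space (hM : M.BClosed) (X : M.SpectralComplex) (k : ℤ) :
    (X.space k).map M.hodge = (M.dualSpectralComplex hM X).space (M.n - k) := by
  by_cases hk : k ∈ X.supp
  · have hk' : M.n - k ∈ (M.dualSpectralComplex hM X).supp := by
      simpa [dualSpectralComplex] using hk
    rw [Multicomplex.SpectralComplex.space, Multicomplex.SpectralComplex.space, if_pos hk,
      if_pos hk', Multicomplex.E, Multicomplex.E]
    simp only [dualSpectralComplex]
    rw [show M.n - (M.n - k) - 1 = k - 1 by ring, show M.n - (M.n - k - 1) - 1 = k by ring,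
      show M.n - (M.n - k) = k by ring]
    exact M.map_hodge_Z_inf hM (X.jump_pos _) (X.jump_pos _) (by ring) (by ring)
  · have hk' : M.n - k ∉ (M.dualSpectralComplex hM X).supp := by
      simpa [dualSpectralComplex] using hk
    rw [Multicomplex.SpectralComplex.space, Multicomplex.SpectralComplex.space, if_neg hk,
      if_neg hk', Submodule.map_bot]

/-- The differential `Δ_j` is adjoint, up to sign, to its conjugate by the Hodge star. -/
theorem inner_Delta (hM : M.BClosed) {j : ℕ} (hj : 1 ≤ j) {p p' k k' q : ℤ}
    (hp : p + p' + j = M.Q) (hk : k + k' + 1 = M.n) (hq : q = k + 1 - p - j)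
    {α β : T} (hα : α ∈ M.Z j p (k - p)) (hβ : β ∈ M.C (p + j) q)
    (hβ' : β ∈ (M.B j (p + j) q)ᗮ) :
    inner ℝ (M.Delta j p k α) β =
      (-1 : ℝ) ^ (M.n * k + 1) * inner ℝ α (M.hodge (M.Delta j p' k' (M.hodge β))) := by
  subst hq
  have hsβ : M.hodge β ∈ M.Z j p' (k' - p') :=
    (M.mem_orthogonal_B_iff hM hj (by linarith) (by linarith) hβ).mp hβ'
  obtain ⟨z, hz, -, hzB⟩ := Multicomplex.isDelta_Delta hM hj hα
  obtain ⟨w, hw, -, hwB⟩ := Multicomplex.isDelta_Delta hM hj hsβ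
  set γ := M.Delta j p k α
  set δ := M.Delta j p' k' (M.hodge β) with hδ
  change M.leading j α z - γ ∈ _ at hzB
  change M.leading j (M.hodge β) w - δ ∈ _ at hwB
  have hδC : δ ∈ M.C (p' + j) (k' + 1 - p' - j) := by
    have h := Submodule.sub_mem _ (M.mem_C_of_eq hw.leading_mem_C rfl
      (by ring : _ = k' + 1 - p' - j)) (M.B_le _ _ _ hwB)
    rwa [sub_sub_cancel] at h
  have hleadC : M.leading j α z ∈ M.C (p + j) (k + 1 - p - j) :=
    M.mem_C_of_eq hz.leading_mem_C rfl (by ring)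
  have h1 : inner ℝ γ β = M.pairing (M.leading j α z) (M.hodge β) := by
    rw [M.pairing_hodge hleadC hβ]
    have := (Submodule.mem_orthogonal _ _).mp hβ' _ hzB
    rw [inner_sub_left] at this
    linarith
  -- the component of the representative in `B_j` is not seen by `α ∈ Z_j`
  have h2 : M.pairing α (M.leading j (M.hodge β) w) = M.pairing α δ := by
    have h := M.pairing_eq_zero_of_mem_B_of_mem_Z (by linarith) (by linarith) hwB hα
    have hC := M.B_le _ _ _ hwB
    rw [← sub_eq_zero, ← map_sub, M.pairing_comm hz.1 hC, h, mul_zero]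
  have hsδ : M.hodge δ ∈ M.C p (k - p) := M.hodge_mem_of_eq hδC (by linarith) (by linarith)
  have h3 : inner ℝ α (M.hodge δ) = (-1 : ℝ) ^ ((k' + 1) * k) * M.pairing α δ := by
    rw [← M.pairing_hodge hz.1 hsδ, M.hodge_hodge _ _ _ hδC, map_smul, smul_eq_mul]
    congr 2
    rw [show p' + (j : ℤ) + (k' + 1 - p' - j) = k' + 1 by ring, ← hk]
    ring
  rw [h1, M.pairing_leading (k := k) (by ring) (by linarith) (by linarith) hz hw, h2, h3,
    ← mul_assoc]
  congr 1
  -- `(n k + 1) + (k' + 1) k = 1 + k + 2 (k' k) + k (k + 1)` with `k' + 1 = n - k`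
  rw [← zpow_add₀ (by norm_num), ← hk,
    show (k + k' + 1) * k + 1 + (k' + 1) * k = k + 1 + (2 * (k' * k) + k * (k + 1)) by ring,
    zpow_add₀ (by norm_num), zpow_add_one₀ (by norm_num),
    Even.neg_one_zpow ((even_two_mul _).add (Int.even_mul_succ_self k))]
  ring

end HodgeMulticomplex

/-! ### A spectral complex that is not self-dual -/

namespace NonSelfDual

/-- The underlying space of the example. The coordinates `0, …, 5` belong to a basis
`1, x₁, x₂, y₂, y₁, vol`. -/
abbrev Space : Type := EuclideanSpace ℝ (Fin 6)

/-- The bidegrees of the basis elements `1, x₁, x₂, y₂, y₁, vol`. -/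
def bideg : Fin 6 → ℤ × ℤ := ![(0, 0), (1, 0), (2, -1), (2, 0), (3, -1), (4, -1)]

/-- The piece of bidegree `(a, b)`. -/
def piece (a b : ℤ) : Submodule ℝ Space where
  carrier := {x | ∀ i, bideg i ≠ (a, b) → x i = 0}
  zero_mem' _ _ := rfl
  add_mem' hx hy i hi := by simp [hx i hi, hy i hi]
  smul_mem' c x hx i hi := by simp [hx i hi]

/-- The differential `x₁ ↦ y₂`, `x₂ ↦ y₁`. -/
def diff : Space →ₗ[ℝ] Space where
  toFun x := !₂[0, 0, 0, x 1, x 2, 0]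
  map_add' x y := by ext i; fin_cases i <;> simp
  map_smul' c x := by ext i; fin_cases i <;> simp

/-- The product with unit `1` and `x₁ y₁ = x₂ y₂ = vol`; the other products of the remaining
basis elements vanish. -/
def wedge : Space →ₗ[ℝ] Space →ₗ[ℝ] Space :=
  LinearMap.mk₂ ℝ (fun x y => !₂[x 0 * y 0, x 0 * y 1 + x 1 * y 0, x 0 * y 2 + x 2 * y 0,
      x 0 * y 3 + x 3 * y 0, x 0 * y 4 + x 4 * y 0,
      x 0 * y 5 + x 5 * y 0 + x 1 * y 4 + x 4 * y 1 + x 2 * y 3 + x 3 * y 2])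
    (fun x x' y => by ext i; fin_cases i <;> simp <;> ring)
    (fun c x y => by ext i; fin_cases i <;> simp <;> ring)
    (fun x y y' => by ext i; fin_cases i <;> simp <;> ring)
    (fun c x y => by ext i; fin_cases i <;> simp <;> ring)

/-- The density `⟨x, y⟩ 1`. -/
def dens : Space →ₗ[ℝ] Space →ₗ[ℝ] Space :=
  LinearMap.mk₂ ℝ (fun x y => !₂[x 0 * y 0 + x 1 * y 1 + x 2 * y 2 + x 3 * y 3 + x 4 * y 4 +
      x 5 * y 5, 0, 0, 0, 0, 0])
    (fun x x' y => by ext i; fin_cases i <;> simp; ring)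
    (fun c x y => by ext i; fin_cases i <;> simp; ring)
    (fun x y y' => by ext i; fin_cases i <;> simp; ring)
    (fun c x y => by ext i; fin_cases i <;> simp; ring)

/-- The Hodge star, which exchanges `1` with `vol` and `x_i` with `y_i`. -/
def star : Space →ₗ[ℝ] Space where
  toFun x := !₂[x 5, x 4, x 3, x 2, x 1, x 0]
  map_add' x y := by ext i; fin_cases i <;> simp
  map_smul' c x := by ext i; fin_cases i <;> simp

/-- The integral: the coefficient of `vol`. -/
def integral : Space →ₗ[ℝ] ℝ where
  toFun x := x 5
  map_add' _ _ := rfl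
  map_smul' _ _ := rfl

theorem integral_apply (x : Space) : integral x = x 5 := rfl

theorem diff_apply (x : Space) : diff x = !₂[0, 0, 0, x 1, x 2, 0] := rfl

theorem star_apply (x : Space) : star x = !₂[x 5, x 4, x 3, x 2, x 1, x 0] := rfl

theorem wedge_apply (x y : Space) : wedge x y =
    !₂[x 0 * y 0, x 0 * y 1 + x 1 * y 0, x 0 * y 2 + x 2 * y 0,
      x 0 * y 3 + x 3 * y 0, x 0 * y 4 + x 4 * y 0,
      x 0 * y 5 + x 5 * y 0 + x 1 * y 4 + x 4 * y 1 + x 2 * y 3 + x 3 * y 2] := rfl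

theorem dens_apply (x y : Space) : dens x y =
    !₂[x 0 * y 0 + x 1 * y 1 + x 2 * y 2 + x 3 * y 3 + x 4 * y 4 + x 5 * y 5,
      0, 0, 0, 0, 0] := rfl

theorem bideg_injective : Function.Injective bideg := by decide

theorem single_mem (i : Fin 6) (c : ℝ) :
    EuclideanSpace.single i c ∈ piece (bideg i).1 (bideg i).2 := by
  intro j hj
  have : j ≠ i := fun h => hj (by rw [h])
  simp [this]

theorem mul_eq_zero_of_ne {a b a' b' : ℤ} {x y : Space} (hx : x ∈ piece a b)
    (hy : y ∈ piece a' b') {i j : Fin 6} (h : bideg i + bideg j ≠ (a + a', b + b')) :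
    x i * y j = 0 := by
  by_cases hi : bideg i = (a, b)
  · rw [hy j fun hj => h (by rw [hi, hj]; rfl), mul_zero]
  · rw [hx i hi, zero_mul]

theorem mul_eq_zero_of_index_ne {a b : ℤ} {x y : Space} (hx : x ∈ piece a b)
    (hy : y ∈ piece a b) {i j : Fin 6} (h : i ≠ j) : x i * y j = 0 := by
  by_cases hi : bideg i = (a, b)
  · rw [hy j fun hj => h (bideg_injective (hi.trans hj.symm)), mul_zero]
  · rw [hx i hi, zero_mul]

theorem sign_mul {a b : ℤ} {x : Space} (hx : x ∈ piece a b) (i : Fin 6) :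
    (-1 : ℝ) ^ (a + b) * x i = (-1 : ℝ) ^ ((bideg i).1 + (bideg i).2) * x i := by
  by_cases hi : bideg i = (a, b)
  · rw [hi]
  · rw [hx i hi, mul_zero, mul_zero]

theorem inner_eq (x y : Space) : inner ℝ x y =
    x 0 * y 0 + x 1 * y 1 + x 2 * y 2 + x 3 * y 3 + x 4 * y 4 + x 5 * y 5 := by
  rw [PiLp.inner_apply, Fin.sum_univ_six]
  simp only [RCLike.inner_apply, conj_trivial]
  ring

theorem isOrtho_piece {a b a' b' : ℤ} (h : (a, b) ≠ (a', b')) :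
    (piece a b).IsOrtho (piece a' b') := by
  rw [Submodule.isOrtho_iff_inner_eq]
  intro x hx y hy
  rw [PiLp.inner_apply]
  refine Finset.sum_eq_zero fun i _ => ?_
  by_cases hi : bideg i = (a, b)
  · rw [hy i fun hi' => h (hi.symm.trans hi'), inner_zero_right]
  · rw [hx i hi, inner_zero_left]

theorem isInternal_piece : DirectSum.IsInternal fun ab : ℤ × ℤ => piece ab.1 ab.2 := by
  refine DirectSum.isInternal_submodule_of_iSupIndep_of_iSup_eq_top ?_ ?_
  · refine OrthogonalFamily.independent (𝕜 := ℝ) ?_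
    intro p q hpq x y
    exact Submodule.isOrtho_iff_inner_eq.mp (isOrtho_piece (by simpa using hpq)) _ x.2 _ y.2
  · rw [eq_top_iff]
    intro x _
    have hx : x = ∑ i, EuclideanSpace.single i (x i) := by
      ext j
      simp
    rw [hx]
    exact Submodule.sum_mem _ fun i _ =>
      Submodule.mem_iSup_of_mem (p := fun ab : ℤ × ℤ => piece ab.1 ab.2) (bideg i)
        (single_mem i (x i))

theorem diff_diff (x : Space) : diff (diff x) = 0 := by
  ext i
  fin_cases i <;> simp [diff_apply]

theorem diff_mem {a b : ℤ} {x : Space} (hx : x ∈ piece a b) : diff x ∈ piece (a + 1) b := by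
  intro i hi
  have h3 : bideg 3 ≠ (a + 1, b) → x 1 = 0 := fun h => hx 1 fun h' => h <| by
    rw [Prod.ext_iff] at h' ⊢
    exact ⟨congrArg (· + 1) h'.1, h'.2⟩
  have h4 : bideg 4 ≠ (a + 1, b) → x 2 = 0 := fun h => hx 2 fun h' => h <| by
    rw [Prod.ext_iff] at h' ⊢
    exact ⟨congrArg (· + 1) h'.1, h'.2⟩
  fin_cases i
  exacts [rfl, rfl, rfl, h3 hi, h4 hi, rfl]

theorem star_mem {a b : ℤ} {x : Space} (hx : x ∈ piece a b) :
    star x ∈ piece (4 - a) (-1 - b) := by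
  have key : ∀ i j : Fin 6, bideg i + bideg j = (4, -1) → bideg i ≠ (4 - a, -1 - b) →
      x j = 0 := by
    intro i j hij hi
    refine hx j fun hj => hi ?_
    rw [hj, Prod.ext_iff] at hij
    exact Prod.ext (eq_sub_of_add_eq hij.1) (eq_sub_of_add_eq hij.2)
  intro i hi
  fin_cases i
  exacts [key 0 5 rfl hi, key 1 4 rfl hi, key 2 3 rfl hi, key 3 2 rfl hi, key 4 1 rfl hi,
    key 5 0 rfl hi]

theorem wedge_mem {a b a' b' : ℤ} {x y : Space} (hx : x ∈ piece a b) (hy : y ∈ piece a' b') :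
    wedge x y ∈ piece (a + a') (b + b') := by
  have key : ∀ {l : Fin 6} (i j : Fin 6), bideg i + bideg j = bideg l →
      bideg l ≠ (a + a', b + b') → x i * y j = 0 := by
    intro l i j h hl
    exact mul_eq_zero_of_ne hx hy (h ▸ hl)
  intro l hl
  rw [wedge_apply]
  fin_cases l
  · exact key 0 0 rfl hl
  · change x 0 * y 1 + x 1 * y 0 = 0
    rw [key 0 1 rfl hl, key 1 0 rfl hl, add_zero]
  · change x 0 * y 2 + x 2 * y 0 = 0
    rw [key 0 2 rfl hl, key 2 0 rfl hl, add_zero]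
  · change x 0 * y 3 + x 3 * y 0 = 0
    rw [key 0 3 rfl hl, key 3 0 rfl hl, add_zero]
  · change x 0 * y 4 + x 4 * y 0 = 0
    rw [key 0 4 rfl hl, key 4 0 rfl hl, add_zero]
  · change x 0 * y 5 + x 5 * y 0 + x 1 * y 4 + x 4 * y 1 + x 2 * y 3 + x 3 * y 2 = 0
    rw [key 0 5 rfl hl, key 5 0 rfl hl, key 1 4 rfl hl, key 4 1 rfl hl, key 2 3 rfl hl,
      key 3 2 rfl hl]
    simp only [add_zero]

theorem wedge_symm (x y : Space) : wedge x y = wedge y x := by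
  rw [wedge_apply, wedge_apply]
  ext i
  fin_cases i <;> simp <;> ring

theorem wedge_comm {a b a' b' : ℤ} {x y : Space} (hx : x ∈ piece a b) (hy : y ∈ piece a' b') :
    wedge x y = (-1 : ℝ) ^ ((a + b) * (a' + b')) • wedge y x := by
  rcases Int.even_or_odd ((a + b) * (a' + b')) with h | h
  · rw [h.neg_one_zpow, one_smul, wedge_symm]
  · -- two elements of odd degree have product zero
    have hodd : ∀ {c e : ℤ} {z : Space}, z ∈ piece c e → Odd (c + e) →
        z 0 = 0 ∧ z 3 = 0 ∧ z 4 = 0 := by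
      intro c e z hz hce
      have key : ∀ i, Even ((bideg i).1 + (bideg i).2) → z i = 0 := by
        intro i hi
        refine hz i fun h' => ?_
        rw [h'] at hi
        exact Int.not_even_iff_odd.mpr hce hi
      exact ⟨key 0 (by decide), key 3 (by decide), key 4 (by decide)⟩
    obtain ⟨h1, h2⟩ := Int.odd_mul.mp h
    obtain ⟨x0, x3, x4⟩ := hodd hx h1
    obtain ⟨y0, y3, y4⟩ := hodd hy h2
    have h0 : wedge x y = 0 := by
      rw [wedge_apply]
      ext i
      fin_cases i <;> simp [x0, x3, x4, y0, y3, y4]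
    rw [wedge_symm y x, h0, smul_zero]

theorem diff_wedge {a b : ℤ} {x : Space} (hx : x ∈ piece a b) (y : Space) :
    diff (wedge x y) = wedge (diff x) y + (-1 : ℝ) ^ (a + b) • wedge x (diff y) := by
  have s0 : (-1 : ℝ) ^ (a + b) * x 0 = x 0 := by simpa [bideg] using sign_mul hx 0
  have s1 : (-1 : ℝ) ^ (a + b) * x 1 = - x 1 := by simpa [bideg] using sign_mul hx 1
  have s2 : (-1 : ℝ) ^ (a + b) * x 2 = - x 2 := by simpa [bideg] using sign_mul hx 2
  ext i
  fin_cases i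
  · simp [wedge_apply, diff_apply]
  · simp [wedge_apply, diff_apply]
  · simp [wedge_apply, diff_apply]
  · simp only [wedge_apply, diff_apply]
    simp
    linear_combination -(y 1) * s0
  · simp only [wedge_apply, diff_apply]
    simp
    linear_combination -(y 2) * s0
  · simp only [wedge_apply, diff_apply]
    simp
    linear_combination -(y 2) * s1 - (y 1) * s2

theorem wedge_star {a b : ℤ} {x y : Space} (hx : x ∈ piece a b) (hy : y ∈ piece a b) :
    wedge x (star y) = wedge (dens x y) (EuclideanSpace.single 5 1) := by
  have h : ∀ i j : Fin 6, i ≠ j → x i * y j = 0 := fun i j => mul_eq_zero_of_index_ne hx hy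
  ext i
  fin_cases i
  · simpa [wedge_apply, star_apply, dens_apply] using h 0 5 (by decide)
  · simp [wedge_apply, star_apply, dens_apply, h 0 4 (by decide), h 1 5 (by decide),
      -mul_eq_zero]
  · simp [wedge_apply, star_apply, dens_apply, h 0 3 (by decide), h 2 5 (by decide),
      -mul_eq_zero]
  · simp [wedge_apply, star_apply, dens_apply, h 0 2 (by decide), h 3 5 (by decide),
      -mul_eq_zero]
  · simp [wedge_apply, star_apply, dens_apply, h 0 1 (by decide), h 4 5 (by decide),
      -mul_eq_zero]
  · simp [wedge_apply, star_apply, dens_apply]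
    ring

theorem star_star (x : Space) : star (star x) = x := by
  ext i
  fin_cases i <;> simp [star_apply]

/-- The six-dimensional Poincaré duality algebra `1, x₁, x₂, y₂, y₁, vol` with `n = 3`, `Q = 4`
and the single differential `d_1`. -/
noncomputable def hodgeMulticomplex : HodgeMulticomplex Space where
  C := piece
  isInternal := isInternal_piece
  orthogonal _ _ _ _ h := isOrtho_piece h
  s := 1
  d i := if i = 1 then diff else 0
  d_mem i a b x hx := by
    split_ifs with hi
    · subst hi
      simpa using diff_mem hx
    · exact Submodule.zero_mem _
  d_eq_zero i hi := if_neg (by omega)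
  d_comp m := by
    refine Finset.sum_eq_zero fun i _ => LinearMap.ext fun x => ?_
    rw [LinearMap.comp_apply, LinearMap.zero_apply]
    split_ifs
    · exact diff_diff x
    all_goals simp
  wedge := wedge
  one := EuclideanSpace.single 0 1
  one_mem := single_mem 0 1
  one_wedge x := by ext i; fin_cases i <;> simp [wedge_apply]
  wedge_assoc x y z := by
    ext i
    fin_cases i <;> simp [wedge_apply] <;> ring
  wedge_mem _ _ _ _ _ _ hx hy := wedge_mem hx hy
  wedge_comm _ _ _ _ _ _ hx hy := wedge_comm hx hy
  leibniz i a b x y hx := by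
    split_ifs
    · exact diff_wedge hx y
    · simp
  n := 3
  Q := 4
  vol := EuclideanSpace.single 5 1
  vol_mem := single_mem 5 1
  integral := integral
  stokes i ω _ := by
    split_ifs
    · rfl
    · simp
  dens := dens
  dens_mem a b x y _ _ := by
    intro i hi
    rw [dens_apply]
    fin_cases i
    exacts [absurd rfl hi, rfl, rfl, rfl, rfl, rfl]
  inner_eq a b x y _ _ := by
    rw [inner_eq]
    rw [integral_apply]
    simp [wedge_apply, dens_apply]
  hodge := star
  hodge_mem a b x hx := star_mem hx
  wedge_star _ _ _ _ hx hy := wedge_star hx hy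
  hodge_hodge a b x _ := by
    have h : Even ((a + b) * (3 - (a + b))) := by
      have := Int.even_mul_succ_self (a + b)
      have e : (a + b) * (3 - (a + b)) = 2 * (2 * (a + b)) - (a + b) * (a + b + 1) := by ring
      rw [e]
      exact (even_two_mul _).sub this
    rw [star_star, h.neg_one_zpow, one_smul]

theorem d_zero : hodgeMulticomplex.d 0 = 0 := rfl

theorem d_one : hodgeMulticomplex.d 1 = diff := rfl

theorem mem_rumin_iff {p k : ℤ} {x : Space} :
    x ∈ hodgeMulticomplex.rumin p k ↔ x ∈ piece p (k - p) := by
  have h : hodgeMulticomplex.rumin p k = piece p (k - p) := by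
    rw [Multicomplex.rumin, d_zero]
    simp [hodgeMulticomplex]
  rw [h]

theorem dc_eq_zero {x : Space} (hx : diff x = 0) (j : ℕ) : hodgeMulticomplex.dc j x = 0 := by
  have hd : ∀ i, hodgeMulticomplex.d i x = 0 := by
    intro i
    change (if i = 1 then diff else 0) x = 0
    split_ifs
    · exact hx
    · rfl
  have hdel : hodgeMulticomplex.del j x = 0 := by
    induction j using Nat.strong_induction_on with
    | _ j ih =>
      rw [Multicomplex.del_apply, hd, zero_sub, neg_eq_zero]
      refine Finset.sum_eq_zero fun i hi => ?_
      rw [ih i (Finset.mem_Ico.mp hi).2, map_zero, map_zero]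
  rw [Multicomplex.dc_apply, hdel]
  simp

theorem dc_one (x : Space) : hodgeMulticomplex.dc 1 x = diff x := by
  rw [Multicomplex.dc_apply, Multicomplex.del_apply, d_zero, d_one]
  simp

theorem diff_eq_zero {x : Space} (h1 : x 1 = 0) (h2 : x 2 = 0) : diff x = 0 := by
  ext i
  fin_cases i <;> simp [diff_apply, h1, h2]

/-- The spectral complex `ℝ x₁ → ℝ y₂`, of weights `1` and `2` in the degrees `1` and `2`. Its
Hodge dual is `ℝ x₂ → ℝ y₁`, of weights `2` and `3`. -/
noncomputable def spectralComplex : hodgeMulticomplex.SpectralComplex where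
  supp := {1, 2}
  wt k := k
  jump _ := 1
  supp_nonempty := ⟨1, by simp⟩
  supp_ordConnected := ⟨fun x hx y hy z hz => by
    simp only [Set.mem_insert_iff, Set.mem_singleton_iff] at hx hy ⊢
    obtain ⟨h1, h2⟩ := hz
    omega⟩
  jump_pos _ := le_rfl
  rumin_ne_bot k hk := by
    rw [Submodule.ne_bot_iff]
    rcases hk with rfl | rfl
    · exact ⟨EuclideanSpace.single 1 1, mem_rumin_iff.mpr (single_mem 1 1), by simp⟩
    · exact ⟨EuclideanSpace.single 3 1, mem_rumin_iff.mpr (single_mem 3 1), by simp⟩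
  wt_succ k _ _ := rfl
  jump_mem k hk hk1 := by
    obtain rfl : k = 1 := by
      simp only [Set.mem_insert_iff, Set.mem_singleton_iff] at hk hk1
      omega
    refine ⟨le_rfl, EuclideanSpace.single 1 1, mem_rumin_iff.mpr (single_mem 1 1), fun h => ?_⟩
    rw [dc_one] at h
    have := congrArg (fun z : Space => z 3) h
    simp [diff_apply] at this
  right_end k hk hk1 := by
    obtain rfl : k = 2 := by
      simp only [Set.mem_insert_iff, Set.mem_singleton_iff] at hk hk1
      omega
    refine Set.eq_empty_iff_forall_notMem.mpr ?_
    rintro j ⟨-, x, hx, hne⟩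
    rw [mem_rumin_iff] at hx
    exact hne (dc_eq_zero (diff_eq_zero (hx 1 (by decide)) (hx 2 (by decide))) j)
  left_end k hk hk1 := by
    obtain rfl : k = 1 := by
      simp only [Set.mem_insert_iff, Set.mem_singleton_iff] at hk hk1
      omega
    rintro l j
    obtain ⟨-, x, hx, hne⟩ := j
    rw [mem_rumin_iff] at hx
    -- an element of degree zero is a multiple of `1`
    have key : ∀ i, (bideg i).1 + (bideg i).2 ≠ 0 → x i = 0 := fun i hi => hx i fun h => hi <| by
      rw [h]
      ring
    exact hne (dc_eq_zero (diff_eq_zero (key 1 (by decide)) (key 2 (by decide))) l)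

theorem space_eq {k : ℤ} (hk : k ∈ spectralComplex.supp) :
    spectralComplex.space k = hodgeMulticomplex.rumin k k := by
  rw [Multicomplex.SpectralComplex.space, if_pos hk, Multicomplex.rumin_eq_E]
  rfl

theorem not_map_star_space :
    ¬ ∀ k, (spectralComplex.space k).map hodgeMulticomplex.hodge =
      spectralComplex.space (hodgeMulticomplex.n - k) := by
  intro h
  have h1 := h 1
  rw [show hodgeMulticomplex.n - 1 = 2 from rfl, space_eq (Or.inl rfl), space_eq (Or.inr rfl)]
    at h1
  have h2 : star (EuclideanSpace.single 1 1) ∈ hodgeMulticomplex.rumin 2 2 := by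
    rw [← h1]
    exact Submodule.mem_map_of_mem (mem_rumin_iff.mpr (single_mem 1 1))
  have h3 := mem_rumin_iff.mp h2 4 (by decide)
  simp [star_apply] at h3

end NonSelfDual

/-! ### Closure under the Hodge star -/

theorem mainTheorem5 :
    (∀ (T : Type u) [NormedAddCommGroup T] [InnerProductSpace ℝ T] (M : HodgeMulticomplex T),
      M.BClosed →
      -- the Hodge star exchanges the two indices of the spaces
      (∀ (r₁ r₂ : ℕ), 1 ≤ r₁ → 1 ≤ r₂ → ∀ p k : ℤ,
        (M.Z r₁ p (k - p) ⊓ (M.B r₂ p (k - p))ᗮ).map M.hodge =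
          M.Z r₂ (M.Q - p) (M.n - k - M.Q + p) ⊓ (M.B r₁ (M.Q - p) (M.n - k - M.Q + p))ᗮ) ∧
      -- the collection of spectral complexes is closed under Hodge duality
      (∀ X : M.SpectralComplex, ∃ Y : M.SpectralComplex,
        (∀ k, k ∈ Y.supp ↔ M.n - k ∈ X.supp) ∧
        (∀ k, Y.wt k = M.Q - X.wt (M.n - k)) ∧
        (∀ k, Y.jump k = X.jump (M.n - k - 1)) ∧
        (∀ k, (X.space k).map M.hodge = Y.space (M.n - k)) ∧
        (∀ k ∈ X.supp, k + 1 ∈ X.supp → ∀ α ∈ X.space k, ∀ β ∈ X.space (k + 1),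
          inner ℝ (X.diff k α) β =
            (-1 : ℝ) ^ (M.n * k + 1) *
              inner ℝ α (M.hodge (Y.diff (M.n - k - 1) (M.hodge β)))))) ∧
    -- a single spectral complex need not be closed under Hodge duality, even if its
    -- degrees are symmetric and it has a non-trivial differential
    (∃ (T : Type) (_ : NormedAddCommGroup T) (_ : InnerProductSpace ℝ T)
        (M : HodgeMulticomplex T) (X : M.SpectralComplex),
      M.BClosed ∧ X.supp.Nontrivial ∧ (∀ k, k ∈ X.supp ↔ M.n - k ∈ X.supp) ∧
        ¬ ∀ k, (X.space k).map M.hodge = X.space (M.n - k)) := by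
  refine ⟨fun T _ _ M hM => ⟨fun r₁ r₂ h₁ h₂ p k =>
      M.map_hodge_Z_inf hM h₁ h₂ (by ring) (by ring), fun X =>
      ⟨M.dualSpectralComplex hM X, fun k => Iff.rfl, fun k => rfl, fun k => rfl,
        M.map_hodge_space hM X, fun k hk hk1 α hα β hβ => ?_⟩⟩,
    NonSelfDual.Space, inferInstance, inferInstance, NonSelfDual.hodgeMulticomplex,
    NonSelfDual.spectralComplex, fun r a b _ => inferInstance, ⟨1, Or.inl rfl, 2, Or.inr rfl,
      by decide⟩, fun k => ?_, NonSelfDual.not_map_star_space⟩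
  · rw [Multicomplex.SpectralComplex.space, if_pos hk] at hα
    rw [Multicomplex.SpectralComplex.space, if_pos hk1, X.wt_succ k hk hk1,
      add_sub_cancel_right] at hβ
    simp only [Multicomplex.SpectralComplex.diff, HodgeMulticomplex.dualSpectralComplex]
    rw [show M.n - (M.n - k - 1) - 1 = k by ring, show M.n - (M.n - k - 1) = k + 1 by ring]
    exact M.inner_Delta hM (X.jump_pos k) (by rw [X.wt_succ k hk hk1]; ring) (by ring) (by ring)
      hα.1 (M.Z_le _ _ _ hβ.1) hβ.2
  · change (k = 1 ∨ k = 2) ↔ (3 - k = 1 ∨ 3 - k = 2)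
    omega
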